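/- Let $\alpha_1,\alpha_2\ge 0$ with $\alpha:=\alpha_1+\alpha_2/2>0$, and let $\epsilon_1,\epsilon_5>0$ be constants independent of $n$, small enough that $(1-\epsilon_1)\sqrt{\alpha}-\epsilon_5\ge 0$. For each $n$ let $m_1=m_1(n)$ and $m_2=m_2(n)$ be non-negative integers with $m_1/n\to\alpha_1$ and $m_2/n\to\alpha_2$ as $n\to\infty$ (in particular $m_i=\alpha_i n$ up to rounding), let $A\in\mathbb{R}^{m_1\times n}$ and $B\in\mathbb{R}^{m_2\times n}$ be random matrices all of whose entries, taken together, are i.i.d. standard normal, and let $c=c^{(n)}\in\mathbb{R}^n$ be a deterministic vector such that $C_{gl}:=\|c\|_2/\sqrt n$ is bounded in $n$. Put $f_{gl}(x)=c^Tx=\sum_{i=1}^n c_ix_i$ and $$\xi_h(f_{gl},A,B)=\min\{\,c^Tx : x\in\mathbb{R}^n,\ Ax=0,\ Bx\le 0,\ \|x\|_2\le 1\,\}.$$ Let $d_l=(1-\epsilon_1)\sqrt{\alpha}-\epsilon_5$ and $d_u=(1+\epsilon_1)\sqrt{\alpha}+\epsilon_5$, and define $$\xi_D^{(l)}(f_{lp})=\begin{cases}-\sqrt{1-d_l^2}\,\sqrt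 n,& d_l^2\le 1,\\ 0,&\text{otherwise,}\end{cases}\qquad \xi_D^{(u)}(f_{lp})=\begin{cases}-\sqrt{1-d_u^2}\,\sqrt n,& d_u^2\le 1,\\ 0,&\text{otherwise.}\end{cases}$$ Set $\xi_D^{(l)}(f_{gl})=C_{gl}\,\xi_D^{(l)}(f_{lp})$ and $\xi_D^{(u)}(f_{gl})=C_{gl}\,\xi_D^{(u)}(f_{lp})$. If $\alpha<1$ and $c^{(n)}\ne 0$ for all large $n$, then $$\lim_{n\to\infty}P\big(\xi_D^{(l)}(f_{gl})<\xi_h(f_{gl},A,B)<\xi_D^{(u)}(f_{gl})\big)=1.$$ Without these two additional assumptions (in particular also for $\alpha\ge 1$), $$\lim_{n\to\infty}P\big(\xi_D^{(l)}(f_{gl})\le\xi_h(f_{gl},A,B)\le\xi_D^{(u)}(f_{gl})\big)=1.$$ -/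

import Mathlib

open Filter Topology MeasureTheory ProbabilityTheory
open scoped Matrix

noncomputable section

namespace RandomProgram

/-- The feasible set `{x ∈ ℝⁿ : A x = 0, B x ≤ 0, ‖x‖₂ ≤ 1}`. -/
def feasible {m₁ m₂ n : ℕ} (A : Matrix (Fin m₁) (Fin n) ℝ) (B : Matrix (Fin m₂) (Fin n) ℝ) :
    Set (EuclideanSpace ℝ (Fin n)) :=
  {x | A *ᵥ x.ofLp = 0 ∧ (∀ i, (B *ᵥ x.ofLp) i ≤ 0) ∧ ‖x‖ ≤ 1}

/-- The optimal value `ξ_h(f, A, B)` of minimizing `f` over the feasible set. -/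
def xiH {m₁ m₂ n : ℕ} (f : EuclideanSpace ℝ (Fin n) → ℝ)
    (A : Matrix (Fin m₁) (Fin n) ℝ) (B : Matrix (Fin m₂) (Fin n) ℝ) : ℝ :=
  sInf (f '' feasible A B)

/-- For a continuous objective the infimum in `xiH` is an attained minimum. -/
theorem isLeast_xiH {m₁ m₂ n : ℕ} {f : EuclideanSpace ℝ (Fin n) → ℝ} (hf : Continuous f)
    (A : Matrix (Fin m₁) (Fin n) ℝ) (B : Matrix (Fin m₂) (Fin n) ℝ) :
    IsLeast (f '' feasible A B) (xiH f A B) := by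
  have hne : (feasible A B).Nonempty := ⟨0, by simp [feasible]⟩
  have hA : Continuous fun x : EuclideanSpace ℝ (Fin n) => A *ᵥ x.ofLp :=
    continuous_const.matrix_mulVec (PiLp.continuous_ofLp 2 _)
  have hB : Continuous fun x : EuclideanSpace ℝ (Fin n) => B *ᵥ x.ofLp :=
    continuous_const.matrix_mulVec (PiLp.continuous_ofLp 2 _)
  have hcl : IsClosed (feasible A B) := by
    refine (isClosed_eq hA continuous_const).inter (IsClosed.inter ?_ ?_)
    · have : {x : EuclideanSpace ℝ (Fin n) | ∀ i, (B *ᵥ x.ofLp) i ≤ 0} =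
          ⋂ i, {x | (B *ᵥ x.ofLp) i ≤ 0} := by ext; simp
      change IsClosed {x : EuclideanSpace ℝ (Fin n) | ∀ i, (B *ᵥ x.ofLp) i ≤ 0}
      rw [this]
      exact isClosed_iInter fun i =>
        isClosed_le ((continuous_apply i).comp hB) continuous_const
    · exact isClosed_le continuous_norm continuous_const
  have hcpt : IsCompact (feasible A B) :=
    (isCompact_closedBall (0 : EuclideanSpace ℝ (Fin n)) 1).of_isClosed_subset hcl
      fun x hx => by simpa using hx.2.2
  exact (hcpt.image hf).isLeast_sInf (hne.image f)

/-- The general linear objective `f_gl(x) = ∑ᵢ cᵢ xᵢ`. -/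
def fgl {n : ℕ} (c : EuclideanSpace ℝ (Fin n)) (x : EuclideanSpace ℝ (Fin n)) : ℝ :=
  ∑ i, c i * x i

/-- The constant `C_gl = ‖c‖₂ / √n`. -/
def Cgl {n : ℕ} (c : EuclideanSpace ℝ (Fin n)) : ℝ := ‖c‖ / √(n : ℝ)

/-- `√D⁽ˡ⁾ = (1 - ε₁) √(α₁ + α₂/2) - ε₅`. -/
def sqrtDl (α₁ α₂ ε₁ ε₅ : ℝ) : ℝ := (1 - ε₁) * √(α₁ + α₂ / 2) - ε₅

/-- `√D⁽ᵘ⁾ = (1 + ε₁) √(α₁ + α₂/2) + ε₅`. -/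
def sqrtDu (α₁ α₂ ε₁ ε₅ : ℝ) : ℝ := (1 + ε₁) * √(α₁ + α₂ / 2) + ε₅

open Classical in
/-- The lower threshold `ξ_D⁽ˡ⁾(f_lp)` for the purely linear objective `∑ᵢ xᵢ`. -/
def xiDl (α₁ α₂ ε₁ ε₅ : ℝ) (n : ℕ) : ℝ :=
  if sqrtDl α₁ α₂ ε₁ ε₅ ^ 2 ≤ 1 then -√(1 - sqrtDl α₁ α₂ ε₁ ε₅ ^ 2) * √(n : ℝ) else 0

open Classical in
/-- The upper threshold `ξ_D⁽ᵘ⁾(f_lp)` for the purely linear objective `∑ᵢ xᵢ`. -/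
def xiDu (α₁ α₂ ε₁ ε₅ : ℝ) (n : ℕ) : ℝ :=
  if sqrtDu α₁ α₂ ε₁ ε₅ ^ 2 ≤ 1 then -√(1 - sqrtDu α₁ α₂ ε₁ ε₅ ^ 2) * √(n : ℝ) else 0

/-- All entries of the random matrices `A` and `B` together are i.i.d. standard normal. -/
structure IsStdGaussianPair {Ω : Type*} [MeasurableSpace Ω] (P : Measure Ω) {m₁ m₂ n : ℕ}
    (A : Ω → Matrix (Fin m₁) (Fin n) ℝ) (B : Ω → Matrix (Fin m₂) (Fin n) ℝ) : Prop where
  lawA : ∀ i j, HasLaw (fun ω => A ω i j) (gaussianReal 0 1) P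
  lawB : ∀ i j, HasLaw (fun ω => B ω i j) (gaussianReal 0 1) P
  indep : iIndepFun
    (fun (k : (Fin m₁ × Fin n) ⊕ (Fin m₂ × Fin n)) (ω : Ω) =>
      Sum.elim (fun p : Fin m₁ × Fin n => A ω p.1 p.2)
        (fun p : Fin m₂ × Fin n => B ω p.1 p.2) k) P

end RandomProgram

end

/-!
The minimum of `⟪c, x⟫` over a closed convex cone intersected with the unit ball is `-‖p‖`, where
`p` is the projection of `-c` on the cone, so the theorem is about the length of the projection
on a random polyhedral cone. For generic rows `p` is the orthogonal projection of `-c` on the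
orthogonal complement of the equality rows and of the active inequality rows. Changing the signs of
the inequality rows does not change their joint law, and for generic rows every set `S` of
inequalities is the active set for exactly one choice of signs, up to the event `p = 0`. Hence `p`
behaves as the residual of `-c` after projecting out `m₁ + |S|` Gaussian vectors, with `S` a
uniformly random set of inequalities, so that `|S|` is close to `m₂ / 2`.

The squared length of the residual of `x` along `k` Gaussian vectors is close to
`(1 - k / n)⁺ ‖x‖²`: by rotation invariance `x` may be replaced by a random sign vector, whose
squared projection on a fixed subspace of dimension `d` is a quadratic form in the signs with mean
`d` and variance at most `2 d`. Altogether `ξ_h ^ 2` is close to `(1 - α)⁺ ‖c‖²`.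
-/

namespace RandomProgram

open scoped RealInnerProductSpace

section Residual

variable {ι E : Type*} [NormedAddCommGroup E] [InnerProductSpace ℝ E]

/-- The orthogonal complement of the vectors `v i`, `i ∈ T`. -/
noncomputable def orthCompl (v : ι → E) (T : Finset ι) : Submodule ℝ E :=
  (Submodule.span ℝ (v '' T))ᗮ

theorem mem_orthCompl {v : ι → E} {T : Finset ι} {x : E} :
    x ∈ orthCompl v T ↔ ∀ i ∈ T, ⟪v i, x⟫ = 0 := by
  rw [orthCompl, ← Submodule.span_singleton_le_iff_mem, ← Submodule.isOrtho_iff_le,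
    Submodule.isOrtho_comm, Submodule.isOrtho_span]
  simp

theorem orthCompl_anti {v : ι → E} {S T : Finset ι} (h : S ⊆ T) :
    orthCompl v T ≤ orthCompl v S :=
  fun _ hx => mem_orthCompl.2 fun i hi => mem_orthCompl.1 hx i (h hi)

theorem orthCompl_smul {v : ι → E} {a : ι → ℝ} (ha : ∀ i, a i ≠ 0) (T : Finset ι) :
    orthCompl (fun i => a i • v i) T = orthCompl v T := by
  ext y
  simp [mem_orthCompl, inner_smul_left, ha]

theorem map_mem_orthCompl_iff (e : E ≃ₗᵢ[ℝ] E) {v : ι → E} {T : Finset ι} {y : E} :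
    y ∈ orthCompl (fun i => e (v i)) T ↔ e.symm y ∈ orthCompl v T := by
  simp only [mem_orthCompl, ← e.inner_map_map _ (e.symm y), e.apply_symm_apply]

theorem inner_starProjection_self_eq_norm_sq (K : Submodule ℝ E) [K.HasOrthogonalProjection]
    (x : E) : ⟪x, K.starProjection x⟫ = ‖K.starProjection x‖ ^ 2 := by
  rw [← real_inner_self_eq_norm_sq, Submodule.inner_starProjection_left_eq_right,
    Submodule.starProjection_eq_self_iff.2 (Submodule.starProjection_apply_mem K x)]

variable [FiniteDimensional ℝ E]

/-- The residual of a vector after projecting out the vectors `v i`, `i ∈ T`, as a linear map. -/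
noncomputable def residual (v : ι → E) (T : Finset ι) : E →L[ℝ] E :=
  (orthCompl v T).starProjection

theorem residual_mem (v : ι → E) (T : Finset ι) (x : E) : residual v T x ∈ orthCompl v T :=
  Submodule.starProjection_apply_mem _ _

theorem inner_residual_of_mem (v : ι → E) {T : Finset ι} (x : E) {i : ι} (hi : i ∈ T) :
    ⟪v i, residual v T x⟫ = 0 :=
  mem_orthCompl.1 (residual_mem v T x) i hi

theorem residual_of_mem (v : ι → E) {T : Finset ι} {i : ι} (hi : i ∈ T) :
    residual v T (v i) = 0 := by
  refine (Submodule.starProjection_apply_eq_zero_iff _).2 ?_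
  exact Submodule.le_orthogonal_orthogonal _ (Submodule.subset_span ⟨i, by simpa using hi, rfl⟩)

theorem inner_sub_residual (v : ι → E) (T : Finset ι) (x : E) {y : E} (hy : y ∈ orthCompl v T) :
    ⟪x - residual v T x, y⟫ = 0 :=
  Submodule.starProjection_inner_eq_zero _ _ hy

theorem inner_residual_left (v : ι → E) (T : Finset ι) (x y : E) :
    ⟪residual v T x, y⟫ = ⟪x, residual v T y⟫ :=
  Submodule.inner_starProjection_left_eq_right _ _ _

theorem residual_eq_self {v : ι → E} {T : Finset ι} {x : E} (hx : x ∈ orthCompl v T) :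
    residual v T x = x :=
  Submodule.starProjection_eq_self_iff.2 hx

theorem inner_residual_of_mem_orthCompl (v : ι → E) {T : Finset ι} (x : E) {y : E}
    (hy : y ∈ orthCompl v T) : ⟪residual v T x, y⟫ = ⟪x, y⟫ := by
  rw [inner_residual_left, residual_eq_self hy]

theorem inner_residual_self (v : ι → E) (T : Finset ι) (x : E) :
    ⟪x, residual v T x⟫ = ‖residual v T x‖ ^ 2 :=
  inner_starProjection_self_eq_norm_sq _ x

theorem eq_residual {v : ι → E} {T : Finset ι} {x p : E} (hp : p ∈ orthCompl v T)
    (h : ∀ y ∈ orthCompl v T, ⟪x - p, y⟫ = 0) : residual v T x = p :=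
  Submodule.eq_starProjection_of_mem_of_inner_eq_zero hp h

theorem norm_residual_anti (v : ι → E) {S T : Finset ι} (h : S ⊆ T) (x : E) :
    ‖residual v T x‖ ≤ ‖residual v S x‖ := by
  have hcomp : residual v T x = residual v T (residual v S x) :=
    (congr($(Submodule.starProjection_comp_starProjection_of_le (orthCompl_anti h)) x)).symm
  rw [hcomp]
  exact Submodule.norm_starProjection_apply_le _ _

theorem residual_ne_zero_anti {v : ι → E} {S T : Finset ι} (h : S ⊆ T) {x : E}
    (hx : residual v T x ≠ 0) : residual v S x ≠ 0 :=
  norm_pos_iff.1 ((norm_pos_iff.2 hx).trans_le (norm_residual_anti v h x))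

theorem exists_eq_residual_add_sum (v : ι → E) (T : Finset ι) (x : E) :
    ∃ l : ι → ℝ, x = residual v T x + ∑ i ∈ T, l i • v i := by
  have hspan : x - residual v T x ∈ Submodule.span ℝ (v '' T) := by
    rw [← Submodule.orthogonal_orthogonal (Submodule.span ℝ (v '' T))]
    exact Submodule.sub_starProjection_mem_orthogonal _
  obtain ⟨l, hl⟩ := (Submodule.mem_span_image_finset_iff_exists_fun' ℝ).1 hspan
  exact ⟨l, by rw [hl, add_sub_cancel]⟩

theorem inner_residual_eq_coeff_mul [DecidableEq ι] {v : ι → E} {T : Finset ι} {j : ι}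
    (hj : j ∉ T) {x p : E} {l : ι → ℝ} (hp : p ∈ orthCompl v (insert j T))
    (hx : x = p + ∑ i ∈ insert j T, l i • v i) :
    ⟪v j, residual v T x⟫ = l j * ‖residual v T (v j)‖ ^ 2 := by
  have hres : residual v T x = p + l j • residual v T (v j) := by
    rw [hx, map_add, residual_eq_self (orthCompl_anti (Finset.subset_insert j T) hp),
      Finset.sum_insert hj, map_add, map_smul, map_sum]
    simp +contextual [residual_of_mem]
  rw [hres, inner_add_right, mem_orthCompl.1 hp j (Finset.mem_insert_self j T), zero_add,
    inner_smul_right, inner_residual_self]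

/-- One Gram–Schmidt step. If `residual v T (v j) = 0` then the subtracted term vanishes. -/
theorem residual_insert [DecidableEq ι] (v : ι → E) (T : Finset ι) (j : ι) (x : E) :
    residual v (insert j T) x = residual v T x -
      (⟪residual v T (v j), residual v T x⟫ / ‖residual v T (v j)‖ ^ 2) •
        residual v T (v j) := by
  set w := residual v T (v j) with hw
  refine eq_residual (mem_orthCompl.2 fun i hi => ?_) fun y hy => ?_
  · rcases Finset.mem_insert.1 hi with rfl | hi
    · rw [inner_sub_right, inner_smul_right, hw, inner_residual_self, ← hw,
        ← inner_residual_of_mem_orthCompl v _ (residual_mem v T x), ← hw]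
      rcases eq_or_ne w 0 with h0 | h0
      · simp [h0]
      · rw [div_mul_cancel₀ _ (by simpa using h0), sub_self]
    · rw [inner_sub_right, inner_smul_right, hw, inner_residual_of_mem _ _ hi,
        inner_residual_of_mem _ _ hi, mul_zero, sub_zero]
  · have hyT := orthCompl_anti (Finset.subset_insert j T) hy
    have hwy : ⟪w, y⟫ = 0 := by
      rw [hw, inner_residual_of_mem_orthCompl v _ hyT]
      exact mem_orthCompl.1 hy j (Finset.mem_insert_self _ _)
    rw [sub_sub_eq_add_sub, add_sub_right_comm, inner_add_left, inner_sub_residual v T x hyT,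
      inner_smul_left, hwy, mul_zero, add_zero]

theorem residual_congr {v w : ι → E} {T : Finset ι} (h : ∀ i ∈ T, v i = w i) :
    residual v T = residual w T := by
  have himage : v '' T = w '' T := Set.image_congr (by simpa using h)
  simp only [residual, orthCompl, himage]

theorem residual_smul {v : ι → E} {a : ι → ℝ} (ha : ∀ i, a i ≠ 0) (T : Finset ι) :
    residual (fun i => a i • v i) T = residual v T := by
  simp only [residual, orthCompl_smul ha]

theorem residual_map (e : E ≃ₗᵢ[ℝ] E) (v : ι → E) (T : Finset ι) (x : E) :
    residual (fun i => e (v i)) T (e x) = e (residual v T x) := by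
  refine eq_residual ?_ fun y hy => ?_
  · rw [map_mem_orthCompl_iff, e.symm_apply_apply]
    exact residual_mem v T x
  · rw [← map_sub, ← e.apply_symm_apply y, e.inner_map_map]
    exact inner_sub_residual v T x ((map_mem_orthCompl_iff e).1 hy)

variable [MeasurableSpace E] [BorelSpace E]

theorem measurable_uncurry_residual (T : Finset ι) :
    Measurable fun q : (ι → E) × E => residual q.1 T q.2 := by
  classical
  induction T using Finset.induction_on with
  | empty =>
    simpa [residual_eq_self (mem_orthCompl (T := ∅).2 (by simp))] using measurable_snd
  | insert j T _ ih =>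
    simp only [residual_insert]
    have hj : Measurable fun q : (ι → E) × E => residual q.1 T (q.1 j) :=
      ih.comp (measurable_fst.prodMk ((measurable_pi_apply j).comp measurable_fst))
    exact ih.sub (((hj.inner ih).div (hj.norm.pow_const 2)).smul hj)

theorem measurable_residual (T : Finset ι) (x : E) :
    Measurable fun v : ι → E => residual v T x :=
  Measurable.of_uncurry_right (f := fun v x => residual v T x) (measurable_uncurry_residual T)

end Residual

section ConeProjection

variable {E : Type*} [NormedAddCommGroup E] [InnerProductSpace ℝ E] [CompleteSpace E]
  (K : ProperCone ℝ E)

theorem exists_mem_properCone_inner_sub (x : E) :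
    ∃ p ∈ K, ⟪x - p, p⟫ = 0 ∧ ∀ y ∈ K, ⟪x - p, y⟫ ≤ 0 := by
  obtain ⟨p, hp, hmin⟩ := exists_norm_eq_iInf_of_complete_convex
    K.nonempty K.isClosed.isComplete K.toPointedCone.convex x
  have hvar := (norm_eq_iInf_iff_real_inner_le_zero K.toPointedCone.convex hp).1 hmin
  have hself : ⟪x - p, p⟫ = 0 := by
    have hzero := hvar 0 K.zero_mem
    have htwo := hvar ((2 : ℝ) • p) (K.smul_mem hp zero_le_two)
    rw [inner_sub_right, inner_zero_right] at hzero
    rw [inner_sub_right, inner_smul_right] at htwo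
    linarith
  refine ⟨p, hp, hself, fun y hy => ?_⟩
  simpa only [inner_sub_right, hself, sub_zero] using hvar y hy

/-- The metric projection onto a closed convex cone, given by the variational inequality that
characterizes it. -/
noncomputable def coneProj (x : E) : E := (exists_mem_properCone_inner_sub K x).choose

theorem coneProj_mem (x : E) : coneProj K x ∈ K :=
  (exists_mem_properCone_inner_sub K x).choose_spec.1

theorem inner_sub_coneProj_self (x : E) : ⟪x - coneProj K x, coneProj K x⟫ = 0 :=
  (exists_mem_properCone_inner_sub K x).choose_spec.2.1

variable {K}

theorem inner_sub_coneProj_le (x : E) {y : E} (hy : y ∈ K) : ⟪x - coneProj K x, y⟫ ≤ 0 :=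
  (exists_mem_properCone_inner_sub K x).choose_spec.2.2 y hy

theorem coneProj_eq {x p : E} (hp : p ∈ K) (hself : ⟪x - p, p⟫ = 0)
    (hle : ∀ y ∈ K, ⟪x - p, y⟫ ≤ 0) : coneProj K x = p := by
  set q := coneProj K x
  have hdist : ⟪q - p, q - p⟫ ≤ 0 := by
    have hq := inner_sub_coneProj_self K x
    have hqp := inner_sub_coneProj_le x hp
    have hpq := hle q (coneProj_mem K x)
    simp only [inner_sub_left, inner_sub_right] at *
    linarith [real_inner_comm p q]
  exact sub_eq_zero.1 (inner_self_eq_zero.1 (hdist.antisymm real_inner_self_nonneg))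

theorem isLeast_inner_image_cone_inter_unitBall (K : ProperCone ℝ E) (c : E) :
    IsLeast ((fun x => ⟪c, x⟫) '' {x | x ∈ K ∧ ‖x‖ ≤ 1}) (-‖coneProj K (-c)‖) := by
  set p := coneProj K (-c)
  constructor
  · refine ⟨‖p‖⁻¹ • p, ⟨K.smul_mem (coneProj_mem K (-c)) (by positivity), ?_⟩, ?_⟩
    · rw [norm_smul, norm_inv, norm_norm]
      exact inv_mul_le_one
    · have hcp : ⟪c, p⟫ = -‖p‖ ^ 2 := by
        have hself : ⟪-c - p, p⟫ = 0 := inner_sub_coneProj_self K (-c)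
        rw [inner_sub_left, inner_neg_left, real_inner_self_eq_norm_sq] at hself
        linarith
      change ⟪c, ‖p‖⁻¹ • p⟫ = -‖p‖
      rw [inner_smul_right, hcp]
      rcases eq_or_ne ‖p‖ 0 with h0 | h0
      · simp [h0]
      · field_simp
  · rintro _ ⟨x, ⟨hxK, hx⟩, rfl⟩
    have hle : ⟪-c - p, x⟫ ≤ 0 := inner_sub_coneProj_le (-c) hxK
    rw [inner_sub_left, inner_neg_left] at hle
    calc -‖p‖ ≤ -(‖p‖ * ‖x‖) := neg_le_neg (mul_le_of_le_one_right (norm_nonneg p) hx)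
      _ ≤ -⟪p, x⟫ := neg_le_neg (real_inner_le_norm p x)
      _ ≤ ⟪c, x⟫ := by linarith

end ConeProjection

section PolyCone

variable {κ ι E : Type*} [NormedAddCommGroup E] [InnerProductSpace ℝ E] [CompleteSpace E]

/-- The polyhedral cone cut out by the equalities `⟪v (inl k), x⟫ = 0` and the inequalities
`⟪v (inr i), x⟫ ≤ 0`, written as a dual cone. -/
noncomputable def polyCone (v : κ ⊕ ι → E) : ProperCone ℝ E :=
  ProperCone.innerDual
    (Set.range (fun k => v (.inl k)) ∪ Set.range (fun k => -v (.inl k)) ∪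
      Set.range fun i => -v (.inr i))

theorem mem_polyCone {v : κ ⊕ ι → E} {x : E} :
    x ∈ polyCone v ↔ (∀ k, ⟪v (.inl k), x⟫ = 0) ∧ ∀ i, ⟪v (.inr i), x⟫ ≤ 0 := by
  simp only [polyCone, ProperCone.mem_innerDual, Set.mem_union, or_imp, forall_and,
    Set.forall_mem_range, inner_neg_left, Left.nonneg_neg_iff, le_antisymm_iff,
    and_comm (a := ∀ k, 0 ≤ ⟪v (.inl k), x⟫)]

theorem exists_pos_add_smul_mem_polyCone [Finite ι] {v : κ ⊕ ι → E} {p y : E}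
    (hp : p ∈ polyCone v) (hk : ∀ k, ⟪v (.inl k), y⟫ = 0)
    (hi : ∀ i, ⟪v (.inr i), p⟫ = 0 → ⟪v (.inr i), y⟫ ≤ 0) :
    ∃ t : ℝ, 0 < t ∧ p + t • y ∈ polyCone v := by
  rw [mem_polyCone] at hp
  have hsmall : ∀ᶠ t in 𝓝[>] (0 : ℝ), ∀ i, ⟪v (.inr i), p + t • y⟫ ≤ 0 := by
    refine eventually_all.2 fun i => ?_
    rcases (hp.2 i).lt_or_eq with hlt | heq
    · have hcont : ContinuousAt (fun t : ℝ => ⟪v (.inr i), p + t • y⟫) 0 := by fun_prop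
      have hneg : ∀ᶠ t in 𝓝 (0 : ℝ), ⟪v (.inr i), p + t • y⟫ < 0 :=
        hcont.eventually_lt continuousAt_const (by simpa using hlt)
      exact (hneg.filter_mono nhdsWithin_le_nhds).mono fun _ h => h.le
    · filter_upwards [self_mem_nhdsWithin] with t ht
      rw [inner_add_right, heq, inner_smul_right, zero_add]
      exact mul_nonpos_of_nonneg_of_nonpos (le_of_lt ht) (hi i heq)
  obtain ⟨t, ht, htpos⟩ := (hsmall.and self_mem_nhdsWithin).exists
  refine ⟨t, htpos, mem_polyCone.2 ⟨fun k => ?_, ht⟩⟩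
  rw [inner_add_right, inner_smul_right, hp.1 k, hk k, mul_zero, add_zero]

theorem inner_sub_coneProj_le_of_tangent [Finite ι] {v : κ ⊕ ι → E} {x y : E}
    (hk : ∀ k, ⟪v (.inl k), y⟫ = 0)
    (hi : ∀ i, ⟪v (.inr i), coneProj (polyCone v) x⟫ = 0 → ⟪v (.inr i), y⟫ ≤ 0) :
    ⟪x - coneProj (polyCone v) x, y⟫ ≤ 0 := by
  obtain ⟨t, ht, hmem⟩ := exists_pos_add_smul_mem_polyCone (coneProj_mem _ x) hk hi
  have hle := inner_sub_coneProj_le x hmem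
  rw [inner_add_right, inner_sub_coneProj_self, inner_smul_right, zero_add] at hle
  exact nonpos_of_mul_nonpos_right hle ht

end PolyCone

section ActiveSet

variable {κ ι E : Type*} [Fintype κ] {S T : Finset ι}

/-- The rows that vanish on the face of `polyCone v` with active inequalities `S`. -/
def faceRows (κ : Type*) [Fintype κ] (S : Finset ι) : Finset (κ ⊕ ι) := Finset.univ.disjSum S

@[simp] theorem inl_mem_faceRows (k : κ) : .inl k ∈ faceRows κ S := by
  simp [faceRows]

@[simp] theorem inr_mem_faceRows {i : ι} : .inr i ∈ faceRows κ S ↔ i ∈ S := by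
  simp [faceRows]

theorem card_faceRows (S : Finset ι) : (faceRows κ S).card = Fintype.card κ + S.card := by
  simp [faceRows]

theorem faceRows_mono (h : S ⊆ T) : faceRows κ S ⊆ faceRows κ T :=
  Finset.disjSum_mono_right _ h

theorem insert_inr_faceRows_erase [DecidableEq κ] [DecidableEq ι] {i : ι} (hi : i ∈ S) :
    insert (.inr i) (faceRows κ (S.erase i)) = faceRows κ S := by
  ext (k | j)
  · simp
  · rcases eq_or_ne j i with rfl | hji <;> simp [*]

variable [NormedAddCommGroup E] [InnerProductSpace ℝ E] [FiniteDimensional ℝ E]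
  {v : κ ⊕ ι → E} {x : E}

theorem residual_faceRows_eq_coneProj [Finite ι]
    (hS : ∀ i, i ∈ S ↔ ⟪v (.inr i), coneProj (polyCone v) x⟫ = 0) :
    residual v (faceRows κ S) x = coneProj (polyCone v) x := by
  have hle : ∀ y ∈ orthCompl v (faceRows κ S), ⟪x - coneProj (polyCone v) x, y⟫ ≤ 0 :=
    fun y hy => inner_sub_coneProj_le_of_tangent (fun k => mem_orthCompl.1 hy _ (by simp))
      fun i hi => (mem_orthCompl.1 hy _ (by simpa using (hS i).2 hi)).le
  refine eq_residual (mem_orthCompl.2 ?_) fun y hy => (hle y hy).antisymm ?_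
  · rintro (k | i) hi
    · exact (mem_polyCone.1 (coneProj_mem _ x)).1 k
    · exact (hS i).1 (by simpa using hi)
  · simpa only [inner_neg_right, Left.neg_nonpos_iff] using hle (-y) (neg_mem hy)

variable [DecidableEq ι]

/-- `S` is the set of active inequalities of the projection of `x` on `polyCone v`, up to
degenerate cases. The positivity of the multiplier of `i ∈ S` is expressed through the residual
along the *other* rows of the face, so that replacing `v i` by `-v i` affects only the condition
for `i`. -/
structure IsActiveSet (v : κ ⊕ ι → E) (x : E) (S : Finset ι) : Prop where
  residual_ne_zero : residual v (faceRows κ S) x ≠ 0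
  inner_neg : ∀ j ∉ S, ⟪v (.inr j), residual v (faceRows κ S) x⟫ < 0
  inner_erase_pos : ∀ i ∈ S, 0 < ⟪v (.inr i), residual v (faceRows κ (S.erase i)) x⟫

theorem IsActiveSet.coeff_nonneg (h : IsActiveSet v x S) {l : κ ⊕ ι → ℝ}
    (hl : x = residual v (faceRows κ S) x + ∑ i ∈ faceRows κ S, l i • v i) {i : ι}
    (hi : i ∈ S) : 0 ≤ l (.inr i) := by
  classical
  have hpos := h.inner_erase_pos i hi
  have hmem := residual_mem v (faceRows κ S) x
  rw [← insert_inr_faceRows_erase hi] at hmem hl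
  rw [inner_residual_eq_coeff_mul (by simp) hmem hl] at hpos
  exact (pos_of_mul_pos_left hpos (sq_nonneg _)).le

theorem IsActiveSet.coneProj_eq (h : IsActiveSet v x S) :
    coneProj (polyCone v) x = residual v (faceRows κ S) x := by
  obtain ⟨l, hl⟩ := exists_eq_residual_add_sum v (faceRows κ S) x
  refine RandomProgram.coneProj_eq (mem_polyCone.2 ⟨fun k => ?_, fun i => ?_⟩)
    (inner_sub_residual _ _ _ (residual_mem _ _ _)) fun y hy => ?_
  · exact inner_residual_of_mem _ _ (by simp)
  · by_cases hi : i ∈ S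
    · exact (inner_residual_of_mem v x (by simpa using hi)).le
    · exact (h.inner_neg i hi).le
  · rw [mem_polyCone] at hy
    rw [sub_eq_of_eq_add' hl, sum_inner]
    refine Finset.sum_nonpos ?_
    rintro (k | i) hi <;> rw [inner_smul_left]
    · rw [hy.1 k, mul_zero]
    · exact mul_nonpos_of_nonneg_of_nonpos (h.coeff_nonneg hl (by simpa using hi)) (hy.2 i)

theorem IsActiveSet.subset (hS : IsActiveSet v x S) (hT : IsActiveSet v x T) : S ⊆ T := by
  intro i hi
  by_contra hiT
  have hneg := hT.inner_neg i hiT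
  rw [← hT.coneProj_eq, hS.coneProj_eq, inner_residual_of_mem v x (by simpa using hi)] at hneg
  exact hneg.false

theorem IsActiveSet.unique (hS : IsActiveSet v x S) (hT : IsActiveSet v x T) : S = T :=
  (hS.subset hT).antisymm (hT.subset hS)

/-- No nonzero residual of `x` is orthogonal to a row that was not projected out. -/
def IsGeneric {ι : Type*} (v : ι → E) (x : E) : Prop :=
  ∀ (T : Finset ι), ∀ j ∉ T, residual v T x ≠ 0 → ⟪v j, residual v T x⟫ ≠ 0

theorem inner_residual_erase_nonneg [Finite ι]
    (hS : ∀ i, i ∈ S ↔ ⟪v (.inr i), coneProj (polyCone v) x⟫ = 0) {i : ι} (hi : i ∈ S) :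
    0 ≤ ⟪v (.inr i), residual v (faceRows κ (S.erase i)) x⟫ := by
  set p := coneProj (polyCone v) x with hp
  set w := residual v (faceRows κ (S.erase i)) (v (.inr i)) with hw
  have hwi : ⟪v (.inr i), w⟫ = ‖w‖ ^ 2 := inner_residual_self ..
  have htangent : ⟪x - p, -w⟫ ≤ 0 := by
    refine inner_sub_coneProj_le_of_tangent (fun k => ?_) fun j hj => ?_
    · rw [inner_neg_right, hw, inner_residual_of_mem _ _ (by simp), neg_zero]
    · rw [inner_neg_right, Left.neg_nonpos_iff]
      rcases eq_or_ne j i with rfl | hji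
      · exact hwi ▸ sq_nonneg _
      · exact (inner_residual_of_mem _ _ (by simpa [hji] using (hS j).2 hj)).ge
  have hpw : ⟪p, w⟫ = 0 := by
    have hmem : p ∈ orthCompl v (faceRows κ (S.erase i)) := by
      refine orthCompl_anti (faceRows_mono (Finset.erase_subset i S)) ?_
      rw [hp, ← residual_faceRows_eq_coneProj hS]
      exact residual_mem _ _ _
    rw [real_inner_comm, hw, inner_residual_of_mem_orthCompl v _ hmem]
    exact (hS i).1 hi
  rw [inner_neg_right, inner_sub_left, hpw, sub_zero, Left.neg_nonpos_iff] at htangent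
  rwa [← inner_residual_left, real_inner_comm]

theorem IsGeneric.exists_isActiveSet [Finite ι] (hgen : IsGeneric v x)
    (h0 : coneProj (polyCone v) x ≠ 0) : ∃ S, IsActiveSet v x S := by
  classical
  have := Fintype.ofFinite ι
  set S : Finset ι := {i | ⟪v (.inr i), coneProj (polyCone v) x⟫ = 0}
  have hS : ∀ i, i ∈ S ↔ ⟪v (.inr i), coneProj (polyCone v) x⟫ = 0 := by simp [S]
  have hres := residual_faceRows_eq_coneProj hS
  have hres0 : residual v (faceRows κ S) x ≠ 0 := hres ▸ h0
  refine ⟨S, hres0, fun j hj => ?_, fun i hi => ?_⟩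
  · rw [hres]
    exact ((mem_polyCone.1 (coneProj_mem _ x)).2 j).lt_of_ne fun h => hj ((hS j).2 h)
  · have herase := residual_ne_zero_anti (faceRows_mono (Finset.erase_subset i S)) hres0
    exact (inner_residual_erase_nonneg hS hi).lt_of_ne' (hgen _ _ (by simp) herase)

end ActiveSet

section Walsh

variable {ι : Type*} [DecidableEq ι]

/-- The sign vector attached to a finite set `s`: `-1` on `s` and `1` off `s`. -/
def sgn (s : Finset ι) (i : ι) : ℝ := if i ∈ s then -1 else 1

/-- The Walsh function of `A` evaluated at the sign vector of `s`. -/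
def walsh (s A : Finset ι) : ℝ := ∏ i ∈ A, sgn s i

theorem sgn_eq_or (s : Finset ι) (i : ι) : sgn s i = 1 ∨ sgn s i = -1 := by
  unfold sgn; split_ifs <;> simp

theorem sgn_ne_zero (s : Finset ι) (i : ι) : sgn s i ≠ 0 := by
  rcases sgn_eq_or s i with h | h <;> norm_num [h]

theorem sgn_mul_self (s : Finset ι) (i : ι) : sgn s i * sgn s i = 1 := by
  rcases sgn_eq_or s i with h | h <;> norm_num [h]

theorem walsh_singleton (s : Finset ι) (i : ι) : walsh s {i} = sgn s i := by
  simp [walsh]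

theorem walsh_pair (s : Finset ι) {i j : ι} (h : i ≠ j) : walsh s {i, j} = sgn s i * sgn s j :=
  Finset.prod_pair h

theorem walsh_comm (s A : Finset ι) : walsh s A = walsh A s := by
  simp only [walsh, sgn, Finset.prod_ite_mem, Finset.inter_comm]

variable [Fintype ι]

theorem sum_walsh_mul_walsh (A B : Finset ι) :
    ∑ s, walsh s A * walsh s B = if A = B then (2 : ℝ) ^ Fintype.card ι else 0 := by
  have hprod : ∑ s, walsh s A * walsh s B = ∏ i, (1 + sgn A i * sgn B i) := by
    rw [Finset.prod_one_add, Finset.powerset_univ]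
    refine Finset.sum_congr rfl fun s _ => ?_
    rw [walsh_comm s A, walsh_comm s B, walsh, walsh, Finset.prod_mul_distrib]
  rw [hprod]
  split_ifs with h
  · simp only [h, sgn_mul_self, one_add_one_eq_two, Finset.prod_const, Finset.card_univ]
  · obtain ⟨i, hi⟩ : ∃ i, ¬(i ∈ A ↔ i ∈ B) := by simpa [Finset.ext_iff] using h
    refine Finset.prod_eq_zero (Finset.mem_univ i) ?_
    by_cases hA : i ∈ A <;> simp_all [sgn]

theorem sum_sq_sum_walsh {τ : Type*} [Fintype τ] {A : τ → Finset ι} (hA : A.Injective)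
    (f : τ → ℝ) :
    ∑ s, (∑ p, f p * walsh s (A p)) ^ 2 = 2 ^ Fintype.card ι * ∑ p, f p ^ 2 := by
  classical
  calc ∑ s, (∑ p, f p * walsh s (A p)) ^ 2
      = ∑ p, ∑ q, f p * f q * ∑ s, walsh s (A p) * walsh s (A q) := by
        simp only [sq, Finset.sum_mul_sum]
        rw [Finset.sum_comm]
        refine Finset.sum_congr rfl fun p _ => ?_
        rw [Finset.sum_comm]
        refine Finset.sum_congr rfl fun q _ => ?_
        rw [Finset.mul_sum]
        exact Finset.sum_congr rfl fun s _ => by ring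
    _ = 2 ^ Fintype.card ι * ∑ p, f p ^ 2 := by
        simp only [sum_walsh_mul_walsh, hA.eq_iff, mul_ite, mul_zero, Finset.sum_ite_eq,
          Finset.mem_univ, if_true, Finset.mul_sum]
        exact Finset.sum_congr rfl fun p _ => by ring

theorem card_filter_pair_eq_le_two (A : Finset ι) :
    (Finset.univ.offDiag.filter fun p : ι × ι => {p.1, p.2} = A).card ≤ 2 := by
  rcases Finset.eq_empty_or_nonempty (Finset.univ.offDiag.filter
    fun p : ι × ι => {p.1, p.2} = A) with h | ⟨⟨i, j⟩, hij⟩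
  · simp [h]
  · obtain rfl : {i, j} = A := (Finset.mem_filter.1 hij).2
    refine (Finset.card_le_card (t := {(i, j), (j, i)}) fun ⟨k, l⟩ hkl => ?_).trans
      Finset.card_le_two
    have hset : ({k, l} : Finset ι) = {i, j} := (Finset.mem_filter.1 hkl).2
    simpa [← Finset.coe_inj, Set.pair_eq_pair_iff] using hset

theorem sum_sq_offDiag_chaos_le (M : ι → ι → ℝ) :
    ∑ s, (∑ p ∈ Finset.univ.offDiag, M p.1 p.2 * (sgn s p.1 * sgn s p.2)) ^ 2 ≤
      2 ^ Fintype.card ι * (2 * ∑ p ∈ Finset.univ.offDiag, M p.1 p.2 ^ 2) := by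
  set fibre : Finset ι → Finset (ι × ι) := fun A =>
    Finset.univ.offDiag.filter fun p => {p.1, p.2} = A
  have hwalsh : ∀ s, ∑ p ∈ Finset.univ.offDiag, M p.1 p.2 * (sgn s p.1 * sgn s p.2) =
      ∑ A, (∑ p ∈ fibre A, M p.1 p.2) * walsh s A := fun s => by
    rw [← Finset.sum_fiberwise _ fun p : ι × ι => ({p.1, p.2} : Finset ι)]
    refine Finset.sum_congr rfl fun A _ => ?_
    rw [Finset.sum_mul]
    refine Finset.sum_congr rfl fun p hp => ?_
    obtain ⟨hoff, rfl⟩ := Finset.mem_filter.1 hp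
    rw [walsh_pair s (Finset.mem_offDiag.1 hoff).2.2]
  simp only [hwalsh]
  refine (sum_sq_sum_walsh Function.injective_id _).trans_le ?_
  gcongr
  rw [← Finset.sum_fiberwise _ fun p : ι × ι => ({p.1, p.2} : Finset ι), Finset.mul_sum]
  refine Finset.sum_le_sum fun A _ => sq_sum_le_card_mul_sum_sq.trans ?_
  gcongr
  exact_mod_cast card_filter_pair_eq_le_two A

theorem sum_sq_chaos_sub_trace_le (M : ι → ι → ℝ) :
    ∑ s, ((∑ i, ∑ j, M i j * (sgn s i * sgn s j)) - ∑ i, M i i) ^ 2 ≤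
      2 ^ Fintype.card ι * (2 * ∑ i, ∑ j, M i j ^ 2) := by
  have hsplit : ∀ f : ι → ι → ℝ,
      ∑ i, ∑ j, f i j = ∑ i, f i i + ∑ p ∈ Finset.univ.offDiag, f p.1 p.2 := fun f => by
    rw [← Fintype.sum_prod_type', ← Finset.univ_product_univ, ← Finset.diag_union_offDiag,
      Finset.sum_union (Finset.disjoint_diag_offDiag _), Finset.sum_diag]
  have hoff : ∀ s, (∑ i, ∑ j, M i j * (sgn s i * sgn s j)) - ∑ i, M i i =
      ∑ p ∈ Finset.univ.offDiag, M p.1 p.2 * (sgn s p.1 * sgn s p.2) := fun s => by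
    rw [hsplit]
    simp only [sgn_mul_self, mul_one, add_sub_cancel_left]
  simp only [hoff, hsplit fun i j => M i j ^ 2]
  refine (sum_sq_offDiag_chaos_le M).trans ?_
  gcongr
  exact le_add_of_nonneg_left (Finset.sum_nonneg fun i _ => sq_nonneg _)

theorem card_sub_half_eq_sum_sgn (s : Finset ι) :
    (s.card : ℝ) - Fintype.card ι / 2 = ∑ i, -(1 / 2) * sgn s i := by
  have hsgn : ∀ i, -(1 / 2) * sgn s i = (if i ∈ s then 1 else 0) - 1 / 2 := fun i => by
    unfold sgn; split_ifs <;> norm_num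
  simp only [hsgn, Finset.sum_sub_distrib]
  simp [div_eq_mul_inv]

end Walsh

section CardConcentration

variable {ι : Type*} [Fintype ι]

theorem sum_sq_card_sub_half :
    ∑ s : Finset ι, ((s.card : ℝ) - Fintype.card ι / 2) ^ 2 =
      (2 : ℝ) ^ Fintype.card ι * (Fintype.card ι / 4) := by
  classical
  simp only [card_sub_half_eq_sum_sgn, ← walsh_singleton]
  rw [sum_sq_sum_walsh Finset.singleton_injective fun _ : ι => -(1 / 2 : ℝ)]
  norm_num [div_eq_mul_inv]

theorem card_filter_le_abs_card_sub_half_le {a : ℝ} (ha : 0 < a) :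
    ((Finset.univ.filter fun s : Finset ι => a ≤ |(s.card : ℝ) - Fintype.card ι / 2|).card : ℝ)
      ≤ 2 ^ Fintype.card ι * (Fintype.card ι / (4 * a ^ 2)) := by
  have hmarkov : ((Finset.univ.filter fun s : Finset ι =>
      a ≤ |(s.card : ℝ) - Fintype.card ι / 2|).card : ℝ) * a ^ 2 ≤
      2 ^ Fintype.card ι * (Fintype.card ι / 4) := by
    rw [← nsmul_eq_mul, ← sum_sq_card_sub_half]
    refine (Finset.card_nsmul_le_sum _ _ _ fun s hs => ?_).trans
      (Finset.sum_le_sum_of_subset_of_nonneg (Finset.subset_univ _) fun _ _ _ => sq_nonneg _)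
    rw [← sq_abs (_ - _)]
    exact pow_le_pow_left₀ ha.le (Finset.mem_filter.1 hs).2 2
  rw [← le_div_iff₀ (by positivity)] at hmarkov
  exact hmarkov.trans_eq (by field_simp)

end CardConcentration

section RandomSigns

variable {κ E : Type*} [NormedAddCommGroup E] [InnerProductSpace ℝ E] [Fintype κ]

theorem norm_sq_sum_sgn_smul [DecidableEq κ] (b : OrthonormalBasis κ ℝ E) (s : Finset κ) :
    ‖∑ k, sgn s k • b k‖ ^ 2 = Fintype.card κ := by
  rw [← real_inner_self_eq_norm_sq, b.orthonormal.inner_sum]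
  simp [sgn_mul_self]

variable [FiniteDimensional ℝ E] (b : OrthonormalBasis κ ℝ E) (K : Submodule ℝ E)

theorem sum_norm_sq_starProjection : ∑ k, ‖K.starProjection (b k)‖ ^ 2 = Module.finrank ℝ K := by
  have hproj : LinearMap.IsProj K (K.starProjection : E →ₗ[ℝ] E) :=
    ⟨fun x => Submodule.starProjection_apply_mem K x,
      fun x hx => Submodule.starProjection_eq_self_iff.2 hx⟩
  rw [← hproj.trace, LinearMap.trace_eq_sum_inner _ b]
  exact Finset.sum_congr rfl fun k _ => (inner_starProjection_self_eq_norm_sq K (b k)).symm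

theorem sum_sq_inner_starProjection :
    ∑ i, ∑ j, ⟪b i, K.starProjection (b j)⟫ ^ 2 = Module.finrank ℝ K := by
  rw [Finset.sum_comm, ← sum_norm_sq_starProjection b]
  simp only [← b.sum_sq_norm_inner_right, Real.norm_eq_abs, sq_abs]

/-- The squared length of the projection of a random sign vector is a quadratic form in the signs
whose expectation is the trace of the projection. -/
theorem sum_sq_norm_sq_starProjection_sub_finrank_le [DecidableEq κ] :
    ∑ s, (‖K.starProjection (∑ k, sgn s k • b k)‖ ^ 2 - Module.finrank ℝ K) ^ 2 ≤
      2 ^ Fintype.card κ * (2 * Fintype.card κ) := by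
  set M : κ → κ → ℝ := fun i j => ⟪b i, K.starProjection (b j)⟫
  have hquad : ∀ s, ‖K.starProjection (∑ k, sgn s k • b k)‖ ^ 2 =
      ∑ i, ∑ j, M i j * (sgn s i * sgn s j) := fun s => by
    rw [← inner_starProjection_self_eq_norm_sq, map_sum, sum_inner]
    refine Finset.sum_congr rfl fun i _ => ?_
    rw [inner_sum]
    refine Finset.sum_congr rfl fun j _ => ?_
    rw [map_smul, real_inner_smul_left, real_inner_smul_right]
    ring
  have htrace : (Module.finrank ℝ K : ℝ) = ∑ i, M i i := by
    rw [← sum_norm_sq_starProjection b]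
    exact Finset.sum_congr rfl fun k _ => (inner_starProjection_self_eq_norm_sq K (b k)).symm
  have hfrobenius : ∑ i, ∑ j, M i j ^ 2 ≤ Fintype.card κ := by
    rw [sum_sq_inner_starProjection, ← Module.finrank_eq_card_basis b.toBasis]
    exact_mod_cast Submodule.finrank_le K
  simp only [hquad, htrace]
  exact (sum_sq_chaos_sub_trace_le M).trans (by gcongr)

end RandomSigns

section GaussianRows

variable {ι E : Type*} [NormedAddCommGroup E] [InnerProductSpace ℝ E] [FiniteDimensional ℝ E]

theorem finrank_le_finrank_orthCompl_add_card (v : ι → E) (T : Finset ι) :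
    Module.finrank ℝ E ≤ Module.finrank ℝ (orthCompl v T) + T.card := by
  classical
  have hspan : Module.finrank ℝ (Submodule.span ℝ (v '' T)) ≤ T.card := by
    rw [← Finset.coe_image]
    exact (finrank_span_finset_le_card _).trans Finset.card_image_le
  have hsum := Submodule.finrank_add_finrank_orthogonal (Submodule.span ℝ (v '' T))
  rw [orthCompl]
  lia

theorem finrank_orthCompl_of_isGeneric {κ : Type*} [Fintype κ] (b : OrthonormalBasis κ ℝ E)
    {v : ι → E} (hv : ∀ k, IsGeneric v (b k)) (T : Finset ι) :
    Module.finrank ℝ (orthCompl v T) = Module.finrank ℝ E - T.card := by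
  classical
  refine le_antisymm ?_ (Nat.sub_le_of_le_add (finrank_le_finrank_orthCompl_add_card v T))
  induction T using Finset.induction_on with
  | empty => simpa using Submodule.finrank_le (orthCompl v ∅)
  | insert j T hj ih =>
    rw [Finset.card_insert_of_notMem hj]
    have hle : orthCompl v (insert j T) ≤ orthCompl v T := orthCompl_anti (Finset.subset_insert j T)
    by_cases hzero : ∀ k, residual v T (b k) = 0
    · have htrace : ∑ k, ‖residual v T (b k)‖ ^ 2 = Module.finrank ℝ (orthCompl v T) :=
        sum_norm_sq_starProjection b (orthCompl v T)
      have hrank : Module.finrank ℝ (orthCompl v T) = 0 := by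
        simp only [hzero, norm_zero, ne_eq, two_ne_zero, not_false_eq_true, zero_pow,
          Finset.sum_const_zero] at htrace
        exact_mod_cast htrace.symm
      have := Submodule.finrank_mono hle
      lia
    · push Not at hzero
      obtain ⟨k, hk⟩ := hzero
      have hlt : orthCompl v (insert j T) < orthCompl v T := hle.lt_of_ne fun h =>
        hv k T j hj hk (mem_orthCompl.1 (h ▸ residual_mem v T (b k)) j (by simp))
      have := Submodule.finrank_lt_finrank_of_lt hlt
      lia

variable [MeasurableSpace E] [BorelSpace E]

theorem stdGaussian_inner_eq_zero {x : E} (hx : x ≠ 0) :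
    stdGaussian E {w | ⟪w, x⟫ = 0} = 0 := by
  have hlaw := IsGaussian.map_eq_gaussianReal (μ := stdGaussian E) (innerSL ℝ x)
  rw [variance_dual_stdGaussian, innerSL_apply_norm] at hlaw
  have hvar : (‖x‖ ^ 2).toNNReal ≠ 0 := by simpa [Real.toNNReal_eq_zero] using hx
  have := nullSingletonClass_gaussianReal (μ := (stdGaussian E)[innerSL ℝ x]) hvar
  have hnull := measure_singleton
    (μ := gaussianReal ((stdGaussian E)[innerSL ℝ x]) (‖x‖ ^ 2).toNNReal) (0 : ℝ)
  rw [← hlaw, Measure.map_apply (by fun_prop) (measurableSet_singleton _)] at hnull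
  simpa [Set.preimage, real_inner_comm] using hnull

/-- The joint law of independent standard Gaussian vectors in `E` indexed by `ι`. -/
noncomputable abbrev gaussianRows (ι E : Type*) [Fintype ι] [NormedAddCommGroup E]
    [InnerProductSpace ℝ E] [FiniteDimensional ℝ E] [MeasurableSpace E] [BorelSpace E] :
    Measure (ι → E) :=
  Measure.pi fun _ => stdGaussian E

theorem map_update_pi {β : Type*} [Fintype ι] [DecidableEq ι] [MeasurableSpace β]
    (μ : ι → Measure β) [∀ i, IsProbabilityMeasure (μ i)] (j : ι) :
    ((Measure.pi μ).prod (μ j)).map (fun q => Function.update q.1 j q.2) = Measure.pi μ := by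
  refine (Measure.pi_eq fun s hs => ?_).symm
  rw [Measure.map_apply measurable_update' (.univ_pi hs)]
  have hpre : (fun q : (ι → β) × β => Function.update q.1 j q.2) ⁻¹' Set.univ.pi s =
      Set.univ.pi (Function.update s j Set.univ) ×ˢ s j := by
    ext ⟨v, w⟩
    simp only [Set.mem_preimage, Set.mem_univ_pi, Set.mem_prod]
    grind [Function.update]
  rw [hpre, Measure.prod_prod, Measure.pi_pi, ← Finset.prod_erase_mul _ _ (Finset.mem_univ j),
    Function.update_self, measure_univ, mul_one,
    ← Finset.prod_erase_mul _ (fun i => μ i (s i)) (Finset.mem_univ j)]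
  congr 1
  exact Finset.prod_congr rfl fun i hi => by rw [Function.update_of_ne (Finset.ne_of_mem_erase hi)]

variable [Fintype ι]

/-- The residual does not depend on the row `v j`, so that row may be resampled. -/
theorem gaussianRows_inner_residual_eq_zero (x : E) {T : Finset ι} {j : ι} (hj : j ∉ T) :
    gaussianRows ι E {v | residual v T x ≠ 0 ∧ ⟪v j, residual v T x⟫ = 0} = 0 := by
  classical
  have hmeas : MeasurableSet {v : ι → E | residual v T x ≠ 0 ∧ ⟪v j, residual v T x⟫ = 0} :=
    (measurableSet_eq_fun (measurable_residual T x) measurable_const).compl.inter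
      (measurableSet_eq_fun ((measurable_pi_apply j).inner (measurable_residual T x))
        measurable_const)
  have hres (v : ι → E) (w : E) : residual (Function.update v j w) T = residual v T :=
    residual_congr fun i hi => Function.update_of_ne (ne_of_mem_of_not_mem hi hj) w v
  rw [gaussianRows, ← map_update_pi _ j, Measure.map_apply measurable_update' hmeas,
    Measure.measure_prod_null (measurable_update' hmeas)]
  refine Eventually.of_forall fun v => ?_
  by_cases hzero : residual v T x = 0
  · simp [hres, hzero]
  · simpa [hres, hzero] using stdGaussian_inner_eq_zero hzero

theorem ae_isGeneric (x : E) : ∀ᵐ v ∂gaussianRows ι E, IsGeneric v x := by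
  simp only [IsGeneric, ae_all_iff]
  intro T j hj
  simpa [ae_iff] using gaussianRows_inner_residual_eq_zero x hj

theorem ae_finrank_orthCompl (T : Finset ι) : ∀ᵐ v ∂gaussianRows ι E,
    Module.finrank ℝ (orthCompl v T) = Module.finrank ℝ E - T.card := by
  filter_upwards [ae_all_iff.2 fun k => ae_isGeneric (stdOrthonormalBasis ℝ E k)] with v hv
  exact finrank_orthCompl_of_isGeneric _ hv T

theorem measurePreserving_isometries (e : ι → E ≃ₗᵢ[ℝ] E) :
    MeasurePreserving (fun (v : ι → E) i => e i (v i)) (gaussianRows ι E) (gaussianRows ι E) :=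
  measurePreserving_pi _ _ fun i => ⟨(e i).continuous.measurable, stdGaussian_map (e i)⟩

theorem measureReal_norm_residual_mem_congr (T : Finset ι) {x y : E} (hxy : ‖x‖ = ‖y‖)
    {G : Set ℝ} (hG : MeasurableSet G) :
    (gaussianRows ι E).real {v | ‖residual v T x‖ ∈ G} =
      (gaussianRows ι E).real {v | ‖residual v T y‖ ∈ G} := by
  set e : E ≃ₗᵢ[ℝ] E := (ℝ ∙ (x - y))ᗮ.reflection
  have hexy : e x = y := Submodule.reflection_sub hxy
  have hmeas : MeasurableSet {v : ι → E | ‖residual v T y‖ ∈ G} :=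
    (measurable_residual T y).norm hG
  rw [← (measurePreserving_isometries fun _ => e).measureReal_preimage hmeas.nullMeasurableSet]
  simp only [Set.preimage_ofPred_eq, ← hexy, residual_map, e.norm_map]

end GaussianRows

section Concentration

theorem sum_measureReal_lt_abs_le {Ω σ : Type*} [MeasurableSpace Ω] [Fintype σ] {μ : Measure Ω}
    [IsProbabilityMeasure μ] {g : σ → Ω → ℝ} (hg : ∀ s, Measurable (g s)) {K : ℝ}
    (h : ∀ᵐ ω ∂μ, ∑ s, g s ω ^ 2 ≤ K) {t : ℝ} (ht : 0 < t) :
    ∑ s, μ.real {ω | t < |g s ω|} ≤ K / t ^ 2 := by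
  have hmeas (s : σ) : MeasurableSet {ω | t < |g s ω|} :=
    measurableSet_lt measurable_const (hg s).abs
  have hint (s : σ) : Integrable ({ω | t < |g s ω|}.indicator (1 : Ω → ℝ)) μ :=
    (integrable_const (1 : ℝ)).indicator (hmeas s)
  have hmarkov (s : σ) (ω : Ω) :
      {ω | t < |g s ω|}.indicator (1 : Ω → ℝ) ω ≤ g s ω ^ 2 / t ^ 2 := by
    refine Set.indicator_apply_le' (fun hω => ?_) fun _ => by positivity
    rw [Pi.one_apply, one_le_div (by positivity), ← sq_abs (g s ω)]
    exact pow_le_pow_left₀ ht.le (le_of_lt hω) 2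
  calc ∑ s, μ.real {ω | t < |g s ω|}
      = ∫ ω, ∑ s, {ω | t < |g s ω|}.indicator (1 : Ω → ℝ) ω ∂μ := by
        simp only [integral_finsetSum _ fun s _ => hint s, integral_indicator_one (hmeas _)]
    _ ≤ ∫ _, K / t ^ 2 ∂μ := by
        refine integral_mono_ae (integrable_finsetSum _ fun s _ => hint s) (integrable_const _) ?_
        filter_upwards [h] with ω hω
        refine (Finset.sum_le_sum fun s _ => hmarkov s ω).trans ?_
        rw [← Finset.sum_div]
        gcongr
    _ = K / t ^ 2 := by simp

variable {ι E : Type*} [Fintype ι] [NormedAddCommGroup E] [InnerProductSpace ℝ E]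
  [FiniteDimensional ℝ E] [MeasurableSpace E] [BorelSpace E]

/-- By rotation invariance `x` may be replaced by a uniformly random sign vector, for which the
deviation is controlled for every fixed realization of the rows. -/
theorem measureReal_lt_abs_norm_sq_residual_sub_le_of_norm_sq_eq (T : Finset ι) {x : E}
    (hx : ‖x‖ ^ 2 = Module.finrank ℝ E) {a : ℝ} (ha : 0 < a) :
    (gaussianRows ι E).real
      {v | a < |‖residual v T x‖ ^ 2 - (Module.finrank ℝ E - T.card : ℕ)|} ≤
        2 * Module.finrank ℝ E / a ^ 2 := by
  set n := Module.finrank ℝ E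
  set d : ℕ := n - T.card
  set b := stdOrthonormalBasis ℝ E
  set z : Finset (Fin n) → E := fun s => ∑ k, sgn s k • b k
  have hz (s : Finset (Fin n)) : ‖z s‖ = ‖x‖ := by
    rw [← sq_eq_sq₀ (norm_nonneg _) (norm_nonneg _), hx, norm_sq_sum_sgn_smul, Fintype.card_fin]
  have hrot (s : Finset (Fin n)) :
      (gaussianRows ι E).real {v | a < |‖residual v T (z s)‖ ^ 2 - d|} =
        (gaussianRows ι E).real {v | a < |‖residual v T x‖ ^ 2 - d|} :=
    measureReal_norm_residual_mem_congr T (hz s) (G := {r | a < |r ^ 2 - d|})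
      (measurableSet_lt measurable_const (by fun_prop))
  have hsum : ∑ s, (gaussianRows ι E).real {v | a < |‖residual v T (z s)‖ ^ 2 - d|} ≤
      2 ^ n * (2 * n) / a ^ 2 := by
    refine sum_measureReal_lt_abs_le
      (fun s => ((measurable_residual T (z s)).norm.pow_const 2).sub_const _) ?_ ha
    filter_upwards [ae_finrank_orthCompl T] with v hv
    have hchaos := sum_sq_norm_sq_starProjection_sub_finrank_le b (orthCompl v T)
    rwa [hv, Fintype.card_fin] at hchaos
  simp only [hrot, Finset.sum_const, Finset.card_univ, Fintype.card_finset, Fintype.card_fin,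
    nsmul_eq_mul, Nat.cast_pow, Nat.cast_ofNat, mul_div_assoc (2 ^ n : ℝ)] at hsum
  exact le_of_mul_le_mul_left hsum (by positivity)

theorem measureReal_lt_abs_norm_sq_residual_sub_le (T : Finset ι) (x : E) {t : ℝ} (ht : 0 < t) :
    (gaussianRows ι E).real {v | t * ‖x‖ ^ 2 < |‖residual v T x‖ ^ 2 -
      (Module.finrank ℝ E - T.card : ℕ) / Module.finrank ℝ E * ‖x‖ ^ 2|} ≤
        2 / (t ^ 2 * Module.finrank ℝ E) := by
  rcases eq_or_ne x 0 with rfl | hx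
  · simpa using (by positivity : 0 ≤ 2 / (t ^ 2 * Module.finrank ℝ E))
  have : Nontrivial E := ⟨x, 0, hx⟩
  have hn : 0 < (Module.finrank ℝ E : ℝ) := by exact_mod_cast Module.finrank_pos
  set n : ℝ := (Module.finrank ℝ E : ℝ)
  have : 0 < ‖x‖ := norm_pos_iff.2 hx
  set z : E := (√n / ‖x‖) • x with hz
  have hscale : ‖√n / ‖x‖‖ ^ 2 = n / ‖x‖ ^ 2 := by
    rw [Real.norm_eq_abs, sq_abs, div_pow, Real.sq_sqrt hn.le]
  have hzn : ‖z‖ ^ 2 = n := by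
    rw [hz, norm_smul, mul_pow, hscale]
    field_simp
  have hset : {v : ι → E | t * ‖x‖ ^ 2 < |‖residual v T x‖ ^ 2 -
      (Module.finrank ℝ E - T.card : ℕ) / n * ‖x‖ ^ 2|} =
      {v | t * n < |‖residual v T z‖ ^ 2 - (Module.finrank ℝ E - T.card : ℕ)|} := by
    ext v
    have hdev : ‖residual v T z‖ ^ 2 - (Module.finrank ℝ E - T.card : ℕ) = n / ‖x‖ ^ 2 *
        (‖residual v T x‖ ^ 2 - (Module.finrank ℝ E - T.card : ℕ) / n * ‖x‖ ^ 2) := by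
      rw [hz, map_smul, norm_smul, mul_pow, hscale]
      field_simp
    rw [Set.mem_ofPred_eq, Set.mem_ofPred_eq, hdev, abs_mul,
      abs_of_pos (show 0 < n / ‖x‖ ^ 2 by positivity),
      div_mul_eq_mul_div n, lt_div_iff₀ (by positivity), mul_right_comm, mul_comm _ n,
      mul_lt_mul_iff_right₀ hn]
  rw [hset]
  refine (measureReal_lt_abs_norm_sq_residual_sub_le_of_norm_sq_eq T hzn
    (mul_pos ht hn)).trans_eq ?_
  change 2 * n / (t * n) ^ 2 = 2 / (t ^ 2 * n)
  field_simp

end Concentration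

section RowSigns

theorem existsUnique_forall_sgn_mul_neg {ι : Type*} [Finite ι] [DecidableEq ι] {g : ι → ℝ}
    (hg : ∀ i, g i ≠ 0) : ∃! s : Finset ι, ∀ i, sgn s i * g i < 0 := by
  have := Fintype.ofFinite ι
  have hneg (s : Finset ι) (i : ι) : sgn s i * g i < 0 ↔ (i ∈ s ↔ 0 < g i) := by
    by_cases hi : i ∈ s
    · simp [sgn, hi]
    · simpa [sgn, hi] using (hg i).le_iff_lt.symm
  refine ⟨Finset.univ.filter (0 < g ·), fun i => (hneg _ i).2 (by simp), fun s hs => ?_⟩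
  ext i
  simpa using (hneg s i).1 (hs i)

variable {κ ι E : Type*} [DecidableEq ι]

/-- The signs `sgn s` on the inequality rows, and no sign change on the equality rows. -/
def rowSgn (κ : Type*) (s : Finset ι) : κ ⊕ ι → ℝ := Sum.elim (fun _ => 1) (sgn s)

theorem rowSgn_ne_zero (s : Finset ι) (i : κ ⊕ ι) : rowSgn κ s i ≠ 0 := by
  rcases i with _ | i
  · exact one_ne_zero
  · exact sgn_ne_zero s i

variable [Fintype κ] [NormedAddCommGroup E] [InnerProductSpace ℝ E] [FiniteDimensional ℝ E]
  {v : κ ⊕ ι → E} {x : E} {S : Finset ι}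

theorem isActiveSet_iff : IsActiveSet v x S ↔ residual v (faceRows κ S) x ≠ 0 ∧
    ∀ i, sgn S i * ⟪v (.inr i), residual v (faceRows κ (S.erase i)) x⟫ < 0 := by
  refine ⟨fun h => ⟨h.residual_ne_zero, fun i => ?_⟩,
    fun h => ⟨h.1, fun j hj => ?_, fun i hi => ?_⟩⟩
  · by_cases hi : i ∈ S
    · simpa [sgn, hi] using h.inner_erase_pos i hi
    · simpa [sgn, hi] using h.inner_neg i hi
  · simpa [sgn, hj] using h.2 j
  · simpa [sgn, hi] using h.2 i

theorem IsGeneric.existsUnique_isActiveSet_rowSgn_smul [Finite ι] (hgen : IsGeneric v x)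
    (hres : residual v (faceRows κ S) x ≠ 0) :
    ∃! s : Finset ι, IsActiveSet (fun i => rowSgn κ s i • v i) x S := by
  set g : ι → ℝ := fun i => sgn S i * ⟪v (.inr i), residual v (faceRows κ (S.erase i)) x⟫
  have hg (i : ι) : g i ≠ 0 := mul_ne_zero (sgn_ne_zero S i) <|
    hgen _ _ (by simp) (residual_ne_zero_anti (faceRows_mono (Finset.erase_subset i S)) hres)
  have hiff (s : Finset ι) : IsActiveSet (fun i => rowSgn κ s i • v i) x S ↔
      ∀ i, sgn s i * g i < 0 := by
    rw [isActiveSet_iff, residual_smul (rowSgn_ne_zero s), and_iff_right hres]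
    simp only [residual_smul (rowSgn_ne_zero s), inner_smul_left, RCLike.conj_to_real,
      mul_left_comm (sgn S _), g]
    rfl
  simpa only [hiff] using existsUnique_forall_sgn_mul_neg hg

end RowSigns

section MixtureLaw

theorem sum_measureReal_eq_of_existsUnique {Ω σ : Type*} [MeasurableSpace Ω] [Fintype σ]
    {μ : Measure Ω} [IsFiniteMeasure μ] {H : σ → Set Ω} {B : Set Ω}
    (hH : ∀ s, MeasurableSet (H s)) (hsub : ∀ s, H s ⊆ B)
    (h : ∀ᵐ ω ∂μ, ω ∈ B → ∃! s, ω ∈ H s) : ∑ s, μ.real (H s) = μ.real B := by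
  have hdisj : Pairwise (Function.onFun (AEDisjoint μ) H) := by
    refine fun s t hst => measure_mono_null (fun ω hω => ?_) (ae_iff.1 h)
    exact fun hB => hst ((hB (hsub s hω.1)).unique hω.1 hω.2)
  have hunion : (⋃ s, H s) =ᵐ[μ] B := by
    filter_upwards [h] with ω hω
    refine propext ⟨fun hmem => ?_, fun hB => Set.mem_iUnion.2 (hω hB).exists⟩
    obtain ⟨s, hs⟩ := Set.mem_iUnion.1 hmem
    exact hsub s hs
  rw [← measureReal_congr hunion, measureReal_def,
    measure_iUnion₀ hdisj fun s => (hH s).nullMeasurableSet, tsum_fintype,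
    ENNReal.toReal_sum fun s _ => measure_ne_top μ (H s)]
  rfl

variable {κ ι E : Type*} [Fintype κ] [NormedAddCommGroup E] [InnerProductSpace ℝ E]
  [FiniteDimensional ℝ E] [MeasurableSpace E] [BorelSpace E]

theorem measurePreserving_rowSgn_smul [Fintype ι] [DecidableEq ι] (s : Finset ι) :
    MeasurePreserving (fun (v : κ ⊕ ι → E) i => rowSgn κ s i • v i)
      (gaussianRows (κ ⊕ ι) E) (gaussianRows (κ ⊕ ι) E) := by
  have hmp := measurePreserving_isometries (E := E) (Sum.elim
    (fun _ : κ => LinearIsometryEquiv.refl ℝ E)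
    fun i => if i ∈ s then LinearIsometryEquiv.neg ℝ else LinearIsometryEquiv.refl ℝ E)
  convert hmp using 3 with v i
  rcases i with k | i
  · simp [rowSgn]
  · by_cases hi : i ∈ s <;> simp [rowSgn, sgn, hi]

theorem measurableSet_isActiveSet [Finite ι] [DecidableEq ι] (x : E) (S : Finset ι) :
    MeasurableSet {v : κ ⊕ ι → E | IsActiveSet v x S} := by
  have hinner (i : κ ⊕ ι) (T : Finset (κ ⊕ ι)) :
      Measurable fun v : κ ⊕ ι → E => ⟪v i, residual v T x⟫ :=
    (measurable_pi_apply i).inner (measurable_residual T x)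
  simp only [isActiveSet_iff]
  refine (measurable_residual _ x (measurableSet_singleton 0)).compl.inter ?_
  refine measurableSet_setOfPred.2 <| Measurable.forall fun i => ?_
  exact measurableSet_setOfPred.1 (measurableSet_lt ((hinner _ _).const_mul _) measurable_const)

variable [Fintype ι]

/-- The `2 ^ card ι` sign changes of the inequality rows partition the event on the right into
equally likely pieces, one for each choice of signs that makes `S` active. -/
theorem two_pow_mul_measureReal_isActiveSet [DecidableEq ι] (x : E) (S : Finset ι)
    {G : Set E} (hG : MeasurableSet G) (hG0 : (0 : E) ∉ G) :
    2 ^ Fintype.card ι * (gaussianRows (κ ⊕ ι) E).real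
        {v | IsActiveSet v x S ∧ residual v (faceRows κ S) x ∈ G} =
      (gaussianRows (κ ⊕ ι) E).real {v | residual v (faceRows κ S) x ∈ G} := by
  have hmeas : MeasurableSet
      {v : κ ⊕ ι → E | IsActiveSet v x S ∧ residual v (faceRows κ S) x ∈ G} :=
    (measurableSet_isActiveSet x S).inter (measurable_residual _ x hG)
  have hflip (s : Finset ι) := (measurePreserving_rowSgn_smul (κ := κ) (E := E)
    s).measureReal_preimage hmeas.nullMeasurableSet
  have hpartition := sum_measureReal_eq_of_existsUnique (μ := gaussianRows (κ ⊕ ι) E)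
    (B := {v | residual v (faceRows κ S) x ∈ G})
    (fun s => (measurePreserving_rowSgn_smul s).measurable hmeas)
    (fun s v hv => by simpa [residual_smul (rowSgn_ne_zero s)] using hv.2) <| by
      filter_upwards [ae_isGeneric x] with v hgen hv
      have hres : residual v (faceRows κ S) x ∈ G := hv
      simpa [residual_smul (rowSgn_ne_zero _), hres] using
        hgen.existsUnique_isActiveSet_rowSgn_smul (ne_of_mem_of_not_mem hres hG0)
  simp only [hflip] at hpartition
  simpa using hpartition

theorem aemeasurable_coneProj (x : E) :
    AEMeasurable (fun v => coneProj (polyCone v) x) (gaussianRows (κ ⊕ ι) E) := by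
  classical
  refine ⟨fun v => ∑ S, {v | IsActiveSet v x S}.indicator
    (fun v => residual v (faceRows κ S) x) v, Finset.measurable_sum _ fun S _ =>
      (measurable_residual _ x).indicator (measurableSet_isActiveSet x S), ?_⟩
  filter_upwards [ae_isGeneric x] with v hgen
  by_cases hzero : coneProj (polyCone v) x = 0
  · have hnone (S : Finset ι) : ¬IsActiveSet v x S := fun h =>
      h.residual_ne_zero (h.coneProj_eq ▸ hzero)
    simp [hnone, hzero]
  · obtain ⟨S, hS⟩ := hgen.exists_isActiveSet hzero
    have hother (T : Finset ι) (hTS : T ≠ S) : v ∉ {v | IsActiveSet v x T} :=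
      fun hT => hTS (IsActiveSet.unique hT hS)
    rw [Finset.sum_eq_single S (fun T _ hTS => Set.indicator_of_notMem (hother T hTS) _) (by simp),
      Set.indicator_of_mem (Set.mem_ofPred_eq ▸ hS), hS.coneProj_eq]

theorem two_pow_mul_measureReal_coneProj_mem_of_zero_notMem (x : E) {G : Set E}
    (hG : MeasurableSet G) (hG0 : (0 : E) ∉ G) :
    2 ^ Fintype.card ι * (gaussianRows (κ ⊕ ι) E).real {v | coneProj (polyCone v) x ∈ G} =
      ∑ S : Finset ι, (gaussianRows (κ ⊕ ι) E).real {v | residual v (faceRows κ S) x ∈ G} := by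
  classical
  have hpartition := sum_measureReal_eq_of_existsUnique (μ := gaussianRows (κ ⊕ ι) E)
    (H := fun S => {v | IsActiveSet v x S ∧ residual v (faceRows κ S) x ∈ G})
    (B := {v | coneProj (polyCone v) x ∈ G})
    (fun S => (measurableSet_isActiveSet x S).inter (measurable_residual _ x hG))
    (fun S v ⟨hS, hv⟩ => by rwa [Set.mem_ofPred_eq, hS.coneProj_eq]) <| by
      filter_upwards [ae_isGeneric x] with v hgen hv
      obtain ⟨S, hS⟩ := hgen.exists_isActiveSet (ne_of_mem_of_not_mem hv hG0)
      exact ⟨S, ⟨hS, hS.coneProj_eq ▸ hv⟩, fun T hT => hT.1.unique hS⟩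
  simp only [← hpartition, Finset.mul_sum, two_pow_mul_measureReal_isActiveSet x _ hG hG0]

theorem two_pow_mul_measureReal_coneProj_mem (x : E) {G : Set E} (hG : MeasurableSet G) :
    2 ^ Fintype.card ι * (gaussianRows (κ ⊕ ι) E).real {v | coneProj (polyCone v) x ∈ G} =
      ∑ S : Finset ι, (gaussianRows (κ ⊕ ι) E).real {v | residual v (faceRows κ S) x ∈ G} := by
  by_cases hG0 : (0 : E) ∈ G
  · have hcone : (gaussianRows (κ ⊕ ι) E).real {v | coneProj (polyCone v) x ∈ Gᶜ} =
        1 - (gaussianRows (κ ⊕ ι) E).real {v | coneProj (polyCone v) x ∈ G} :=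
      probReal_compl_eq_one_sub₀ ((aemeasurable_coneProj x).nullMeasurableSet_preimage hG)
    have hres (S : Finset ι) : (gaussianRows (κ ⊕ ι) E).real
        {v | residual v (faceRows κ S) x ∈ Gᶜ} =
        1 - (gaussianRows (κ ⊕ ι) E).real {v | residual v (faceRows κ S) x ∈ G} :=
      probReal_compl_eq_one_sub (measurable_residual _ x hG)
    have hcompl := two_pow_mul_measureReal_coneProj_mem_of_zero_notMem (κ := κ) (ι := ι) x
      hG.compl (not_not.2 hG0)
    simp only [hcone, hres, Finset.sum_sub_distrib, Finset.sum_const, Finset.card_univ,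
      Fintype.card_finset, nsmul_eq_mul, Nat.cast_pow, Nat.cast_ofNat, mul_one, mul_sub] at hcompl
    linarith
  · exact two_pow_mul_measureReal_coneProj_mem_of_zero_notMem x hG hG0

/-- The number of active inequalities is binomial, hence typically close to `card ι / 2`. -/
theorem measureReal_coneProj_mem_le (x : E) {G : Set E} (hG : MeasurableSet G) {a η : ℝ}
    (ha : 0 < a) (hη : 0 ≤ η) (h : ∀ S : Finset ι, |(S.card : ℝ) - Fintype.card ι / 2| < a →
      (gaussianRows (κ ⊕ ι) E).real {v | residual v (faceRows κ S) x ∈ G} ≤ η) :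
    (gaussianRows (κ ⊕ ι) E).real {v | coneProj (polyCone v) x ∈ G} ≤
      Fintype.card ι / (4 * a ^ 2) + η := by
  have hbound (S : Finset ι) :
      (gaussianRows (κ ⊕ ι) E).real {v | residual v (faceRows κ S) x ∈ G} ≤
        (if a ≤ |(S.card : ℝ) - Fintype.card ι / 2| then 1 else 0) + η := by
    split_ifs with hS
    · linarith [measureReal_le_one (μ := gaussianRows (κ ⊕ ι) E)
        (s := {v | residual v (faceRows κ S) x ∈ G})]
    · simpa using h S (not_le.1 hS)
  have hcount := card_filter_le_abs_card_sub_half_le (ι := ι) ha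
  refine le_of_mul_le_mul_left ?_ (by positivity : (0 : ℝ) < 2 ^ Fintype.card ι)
  rw [two_pow_mul_measureReal_coneProj_mem x hG]
  refine (Finset.sum_le_sum fun S _ => hbound S).trans ?_
  rw [Finset.sum_add_distrib, Finset.sum_boole, Finset.sum_const, Finset.card_univ,
    Fintype.card_finset, nsmul_eq_mul, mul_add]
  push_cast
  linarith

end MixtureLaw

section ProjectionConcentration

variable {κ ι E : Type*} [Fintype κ] [Fintype ι] [NormedAddCommGroup E] [InnerProductSpace ℝ E]
  [FiniteDimensional ℝ E] [MeasurableSpace E] [BorelSpace E]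

theorem natCast_tsub_div_eq_max (m : ℕ) {n : ℕ} (hn : 0 < n) :
    ((n - m : ℕ) : ℝ) / n = max (0 : ℝ) (1 - m / n) := by
  have hn' : (0 : ℝ) < n := by exact_mod_cast hn
  rcases le_total m n with h | h
  · rw [Nat.cast_sub h, sub_div, div_self hn'.ne', max_eq_right]
    exact sub_nonneg.2 ((div_le_one hn').2 (Nat.cast_le.2 h))
  · rw [Nat.sub_eq_zero_of_le h, Nat.cast_zero, zero_div, max_eq_left]
    exact sub_nonpos.2 ((one_le_div hn').2 (Nat.cast_le.2 h))

theorem half_mul_lt_abs_sub_of_abs_sub_le_half {s s' t q y : ℝ} (hq : 0 ≤ q) (hs : |s - s'| ≤ t / 2)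
    (h : t * q < |y - s' * q|) : t / 2 * q < |y - s * q| := by
  have htri := abs_sub_le y (s * q) (s' * q)
  rw [← sub_mul, abs_mul, abs_of_nonneg hq] at htri
  linarith [mul_le_mul_of_nonneg_right hs hq]

theorem measureReal_lt_abs_norm_sq_coneProj_sub_le [Nontrivial E] (x : E) {t : ℝ} (ht : 0 < t) :
    (gaussianRows (κ ⊕ ι) E).real {v | t * ‖x‖ ^ 2 < |‖coneProj (polyCone v) x‖ ^ 2 -
      max (0 : ℝ) (1 - (Fintype.card κ + Fintype.card ι / 2) / Module.finrank ℝ E) * ‖x‖ ^ 2|} ≤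
        Fintype.card ι / (t * Module.finrank ℝ E) ^ 2 + 8 / (t ^ 2 * Module.finrank ℝ E) := by
  have hn : 0 < Module.finrank ℝ E := Module.finrank_pos
  have hn' : (0 : ℝ) < Module.finrank ℝ E := by exact_mod_cast hn
  set n := Module.finrank ℝ E
  set β : ℝ := max 0 (1 - (Fintype.card κ + Fintype.card ι / 2) / n) with hβ
  have hG : MeasurableSet {p : E | t * ‖x‖ ^ 2 < |‖p‖ ^ 2 - β * ‖x‖ ^ 2|} :=
    measurableSet_lt measurable_const (by fun_prop)
  refine (measureReal_coneProj_mem_le (κ := κ) (ι := ι) x hG (a := t * n / 2)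
    (η := 8 / (t ^ 2 * n)) (by positivity) (by positivity) fun S hS => ?_).trans_eq ?_
  · set d : ℝ := ((n - (faceRows κ S).card : ℕ) : ℝ) / n with hd
    have hdβ : |d - β| ≤ t / 2 := by
      rw [hd, hβ, natCast_tsub_div_eq_max _ hn, card_faceRows, max_comm, max_comm 0]
      refine (abs_max_sub_max_le_abs _ _ _).trans ?_
      rw [sub_sub_sub_cancel_left, ← sub_div, abs_div, abs_of_pos hn', div_le_iff₀ hn',
        abs_sub_comm, Nat.cast_add, add_sub_add_left_eq_sub]
      linarith
    refine (measureReal_mono fun v hv =>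
      half_mul_lt_abs_sub_of_abs_sub_le_half (sq_nonneg ‖x‖) hdβ hv).trans
        ((measureReal_lt_abs_norm_sq_residual_sub_le (faceRows κ S) x (half_pos ht)).trans_eq ?_)
    change 2 / ((t / 2) ^ 2 * n) = 8 / (t ^ 2 * n)
    field_simp
    norm_num
  · congr 2
    ring

theorem measureReal_coneProj_ne_zero_le (x : E)
    (h : (Module.finrank ℝ E : ℝ) < Fintype.card κ + Fintype.card ι / 2) :
    (gaussianRows (κ ⊕ ι) E).real {v | coneProj (polyCone v) x ≠ 0} ≤
      Fintype.card ι /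
        (4 * (Fintype.card κ + Fintype.card ι / 2 - Module.finrank ℝ E : ℝ) ^ 2) := by
  refine (measureReal_coneProj_mem_le x (measurableSet_singleton 0).compl (sub_pos.2 h) le_rfl
    fun S hS => ?_).trans_eq (add_zero _)
  have hcard : Module.finrank ℝ E - (faceRows κ S).card = 0 := by
    rw [card_faceRows, Nat.sub_eq_zero_iff_le, ← Nat.cast_le (α := ℝ), Nat.cast_add]
    linarith [neg_lt_of_abs_lt hS]
  have hae : ∀ᵐ v ∂gaussianRows (κ ⊕ ι) E, residual v (faceRows κ S) x = 0 := by
    filter_upwards [ae_finrank_orthCompl (E := E) (faceRows κ S)] with v hv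
    rw [hcard, Submodule.finrank_eq_zero] at hv
    simpa [hv] using residual_mem v (faceRows κ S) x
  exact ((measureReal_eq_zero_iff (measure_ne_top _ _)).2 (ae_iff.1 hae)).le

end ProjectionConcentration

section OptimalValue

variable {m₁ m₂ n : ℕ}

/-- The rows of `A` followed by the rows of `B`, as Euclidean vectors. -/
noncomputable def rows (A : Matrix (Fin m₁) (Fin n) ℝ) (B : Matrix (Fin m₂) (Fin n) ℝ) :
    Fin m₁ ⊕ Fin m₂ → EuclideanSpace ℝ (Fin n) :=
  Sum.elim (fun i => WithLp.toLp 2 (A i)) fun i => WithLp.toLp 2 (B i)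

theorem inner_toLp_row {m : ℕ} (A : Matrix (Fin m) (Fin n) ℝ) (i : Fin m)
    (x : EuclideanSpace ℝ (Fin n)) : ⟪WithLp.toLp 2 (A i), x⟫ = (A *ᵥ x.ofLp) i := by
  simp [PiLp.inner_apply, Matrix.mulVec, dotProduct, mul_comm]

theorem feasible_eq_polyCone_inter_unitBall (A : Matrix (Fin m₁) (Fin n) ℝ)
    (B : Matrix (Fin m₂) (Fin n) ℝ) :
    feasible A B = {x | x ∈ polyCone (rows A B) ∧ ‖x‖ ≤ 1} := by
  ext x
  simp only [feasible, Set.mem_ofPred_eq, mem_polyCone, rows, Sum.elim_inl, Sum.elim_inr,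
    inner_toLp_row, funext_iff, Pi.zero_apply, and_assoc]

theorem fgl_eq_inner (c x : EuclideanSpace ℝ (Fin n)) : fgl c x = ⟪c, x⟫ := by
  simp [fgl, PiLp.inner_apply, mul_comm]

theorem xiH_fgl_eq_neg_norm_coneProj (c : EuclideanSpace ℝ (Fin n))
    (A : Matrix (Fin m₁) (Fin n) ℝ) (B : Matrix (Fin m₂) (Fin n) ℝ) :
    xiH (fgl c) A B = -‖coneProj (polyCone (rows A B)) (-c)‖ := by
  rw [xiH, feasible_eq_polyCone_inter_unitBall, funext (fgl_eq_inner c)]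
  exact (isLeast_inner_image_cone_inter_unitBall _ c).csInf_eq

end OptimalValue

section Law

variable {Ω : Type*} [MeasurableSpace Ω] {P : Measure Ω}

theorem hasLaw_gaussianRows {κ ι : Type*} [Fintype κ] [Fintype ι] {X : κ → ι → Ω → ℝ}
    (hlaw : ∀ k j, HasLaw (X k j) (gaussianReal 0 1) P)
    (hindep : iIndepFun (fun p : κ × ι => X p.1 p.2) P) :
    HasLaw (fun ω k => WithLp.toLp 2 fun j => X k j ω)
      (gaussianRows κ (EuclideanSpace ℝ ι)) P := by
  have hentries := hindep.hasLaw_pi (fun p : κ × ι => hlaw p.1 p.2)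
  have hcurry : HasLaw (MeasurableEquiv.curry κ ι ℝ)
      (Measure.pi fun _ => Measure.pi fun _ => gaussianReal 0 1)
      (Measure.pi fun _ : κ × ι => gaussianReal 0 1) := by
    refine ⟨by fun_prop, ?_⟩
    simpa only [Measure.infinitePi_eq_pi] using
      Measure.infinitePi_map_curry (fun (_ : κ) (_ : ι) => gaussianReal 0 1)
  have htoLp : HasLaw (fun (w : κ → ι → ℝ) k => WithLp.toLp 2 (w k))
      (gaussianRows κ (EuclideanSpace ℝ ι))
      (Measure.pi fun _ => Measure.pi fun _ => gaussianReal 0 1) :=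
    (measurePreserving_pi _ _ fun _ =>
      ⟨WithLp.measurable_toLp 2 _, map_pi_eq_stdGaussian⟩).hasLaw
  exact htoLp.comp (hcurry.comp hentries)

variable {m₁ m₂ n : ℕ} {A : Ω → Matrix (Fin m₁) (Fin n) ℝ} {B : Ω → Matrix (Fin m₂) (Fin n) ℝ}

theorem IsStdGaussianPair.hasLaw_rows (h : IsStdGaussianPair P A B) :
    HasLaw (fun ω => rows (A ω) (B ω))
      (gaussianRows (Fin m₁ ⊕ Fin m₂) (EuclideanSpace ℝ (Fin n))) P := by
  have hrows := hasLaw_gaussianRows (P := P)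
    (X := Sum.elim (fun i j ω => A ω i j) fun i j ω => B ω i j)
    (by rintro (i | i) j; exacts [h.lawA i j, h.lawB i j]) <| by
      convert h.indep.precomp (Equiv.sumProdDistrib (Fin m₁) (Fin m₂) (Fin n)).injective with p
      rcases p with ⟨i | i, j⟩ <;> rfl
  convert hrows using 3 with ω k
  rcases k with i | i <;> rfl

theorem IsStdGaussianPair.measureReal_xiH_mem (h : IsStdGaussianPair P A B)
    (c : EuclideanSpace ℝ (Fin n)) {I : Set ℝ} (hI : MeasurableSet I) :
    P.real {ω | xiH (fgl c) (A ω) (B ω) ∈ I} =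
      (gaussianRows (Fin m₁ ⊕ Fin m₂) (EuclideanSpace ℝ (Fin n))).real
        {v | -‖coneProj (polyCone v) (-c)‖ ∈ I} := by
  have hnull : NullMeasurableSet {v | -‖coneProj (polyCone v) (-c)‖ ∈ I}
      (gaussianRows (Fin m₁ ⊕ Fin m₂) (EuclideanSpace ℝ (Fin n))) :=
    (aemeasurable_coneProj (-c)).norm.neg.nullMeasurableSet_preimage hI
  rw [← h.hasLaw_rows.map_eq] at hnull
  simp only [xiH_fgl_eq_neg_norm_coneProj]
  rw [measureReal_def, measureReal_def, ← h.hasLaw_rows.map_eq,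
    Measure.map_apply₀ h.hasLaw_rows.aemeasurable hnull]
  rfl

end Law

section Limits

theorem tendsto_measure_one_of_tendsto_measureReal_zero {Ω : ℕ → Type*}
    [∀ n, MeasurableSpace (Ω n)] {P : ∀ n, Measure (Ω n)} [∀ n, IsProbabilityMeasure (P n)]
    {good bad : ∀ n, Set (Ω n)} (hbad : Tendsto (fun n => (P n).real (bad n)) atTop (𝓝 0))
    (h : ∀ᶠ n in atTop, ∀ ω ∉ bad n, ω ∈ good n) :
    Tendsto (fun n => P n (good n)) atTop (𝓝 1) := by
  have hbad' : Tendsto (fun n => P n (bad n)) atTop (𝓝 0) :=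
    (ENNReal.tendsto_toReal_zero_iff fun n => measure_ne_top _ _).1 hbad
  have hlower : Tendsto (fun n => 1 - P n (bad n)) atTop (𝓝 1) := by
    simpa using ENNReal.Tendsto.sub tendsto_const_nhds hbad' (Or.inl ENNReal.one_ne_top)
  refine tendsto_of_tendsto_of_tendsto_of_le_of_le' hlower tendsto_const_nhds ?_
    (Eventually.of_forall fun n => prob_le_one)
  filter_upwards [h] with n hn
  have hcover : Set.univ ⊆ good n ∪ bad n := fun ω _ => or_iff_not_imp_right.2 (hn ω)
  rw [tsub_le_iff_right, ← measure_univ (μ := P n)]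
  exact (measure_mono hcover).trans (measure_union_le _ _)

theorem neg_sqrt_mul_le_of_abs_sq_sub_le {a s t r y : ℝ} (hr : 0 ≤ r)
    (h : |y ^ 2 - s * r ^ 2| ≤ t * r ^ 2) (ha : s + t ≤ a) : -√a * r ≤ y := by
  have hsq : y ^ 2 ≤ a * r ^ 2 := by
    linarith [le_of_abs_le h, mul_le_mul_of_nonneg_right ha (sq_nonneg r)]
  have habs := Real.abs_le_sqrt hsq
  rw [Real.sqrt_mul' _ (sq_nonneg r), Real.sqrt_sq hr] at habs
  linarith [neg_abs_le y]

theorem le_neg_sqrt_mul_of_abs_sq_sub_le {b s t r y : ℝ} (hr : 0 ≤ r) (hy : y ≤ 0)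
    (h : |y ^ 2 - s * r ^ 2| ≤ t * r ^ 2) (hb : b ≤ s - t) : y ≤ -√b * r := by
  have hsq : b * r ^ 2 ≤ y ^ 2 := by
    linarith [neg_le_of_abs_le h, mul_le_mul_of_nonneg_right hb (sq_nonneg r)]
  have hsqrt := Real.sqrt_le_sqrt hsq
  rw [Real.sqrt_mul' _ (sq_nonneg r), Real.sqrt_sq hr, Real.sqrt_sq_eq_abs,
    abs_of_nonpos hy] at hsqrt
  linarith

variable {m₁ m₂ : ℕ → ℕ} {α : ℝ}

theorem tendsto_div_sq_zero
    (hm : Tendsto (fun n : ℕ => (m₁ n + m₂ n / 2 : ℝ) / n) atTop (𝓝 α)) :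
    Tendsto (fun n : ℕ => (m₂ n : ℝ) / n ^ 2) atTop (𝓝 0) := by
  have hlim := (hm.const_mul 2).mul (tendsto_inv_atTop_nhds_zero_nat (𝕜 := ℝ))
  rw [mul_zero] at hlim
  refine squeeze_zero (fun n => by positivity) (fun n => ?_) hlim
  rw [pow_two, ← div_div, div_eq_mul_inv _ (n : ℝ), mul_div_assoc']
  gcongr
  linarith [(m₁ n).cast_nonneg (α := ℝ)]

variable {Ω : ℕ → Type*} [∀ n, MeasurableSpace (Ω n)] {P : ∀ n, Measure (Ω n)}
  {A : ∀ n, Ω n → Matrix (Fin (m₁ n)) (Fin n) ℝ} {B : ∀ n, Ω n → Matrix (Fin (m₂ n)) (Fin n) ℝ}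

theorem tendsto_measureReal_lt_abs_xiH_sq_sub
    (hm : Tendsto (fun n : ℕ => (m₁ n + m₂ n / 2 : ℝ) / n) atTop (𝓝 α))
    (hAB : ∀ n, IsStdGaussianPair (P n) (A n) (B n)) (c : ∀ n, EuclideanSpace ℝ (Fin n))
    {t : ℝ} (ht : 0 < t) :
    Tendsto (fun n => (P n).real {ω | t * ‖c n‖ ^ 2 <
      |xiH (fgl (c n)) (A n ω) (B n ω) ^ 2 - max 0 (1 - α) * ‖c n‖ ^ 2|}) atTop (𝓝 0) := by
  have hbound : Tendsto (fun n : ℕ => (m₂ n : ℝ) / (t / 2 * n) ^ 2 + 8 / ((t / 2) ^ 2 * n))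
      atTop (𝓝 0) := by
    have hlim := ((tendsto_div_sq_zero hm).div_const ((t / 2) ^ 2)).add
      (tendsto_const_div_atTop_nhds_zero_nat (8 / (t / 2) ^ 2))
    rw [zero_div, add_zero] at hlim
    refine hlim.congr fun n => ?_
    rw [div_div, div_div, mul_pow, mul_comm]
  have hratio : Tendsto (fun n : ℕ => max 0 (1 - (m₁ n + m₂ n / 2 : ℝ) / n)) atTop
      (𝓝 (max 0 (1 - α))) := tendsto_const_nhds.max (hm.const_sub 1)
  refine squeeze_zero' (Eventually.of_forall fun _ => measureReal_nonneg) ?_ hbound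
  filter_upwards [Metric.tendsto_nhds.1 hratio (t / 2) (half_pos ht), eventually_gt_atTop 0]
    with n hclose hn
  have : Nontrivial (EuclideanSpace ℝ (Fin n)) :=
    Module.nontrivial_of_finrank_pos (R := ℝ) (by simpa using hn)
  have hI : MeasurableSet {y : ℝ | t * ‖c n‖ ^ 2 < |y ^ 2 - max 0 (1 - α) * ‖c n‖ ^ 2|} :=
    measurableSet_lt measurable_const (by fun_prop)
  have hproj := measureReal_lt_abs_norm_sq_coneProj_sub_le (κ := Fin (m₁ n)) (ι := Fin (m₂ n))
    (-c n) (half_pos ht)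
  simp only [Fintype.card_fin, finrank_euclideanSpace, norm_neg] at hproj
  refine ((hAB n).measureReal_xiH_mem (c n) hI).trans_le
    ((measureReal_mono fun v hv => ?_).trans hproj)
  simp only [Set.mem_ofPred_eq, neg_sq] at hv ⊢
  exact half_mul_lt_abs_sub_of_abs_sub_le_half (sq_nonneg _) hclose.le hv

theorem tendsto_measureReal_xiH_ne_zero
    (hm : Tendsto (fun n : ℕ => (m₁ n + m₂ n / 2 : ℝ) / n) atTop (𝓝 α))
    (hAB : ∀ n, IsStdGaussianPair (P n) (A n) (B n)) (c : ∀ n, EuclideanSpace ℝ (Fin n))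
    (hα : 1 < α) :
    Tendsto (fun n => (P n).real {ω | xiH (fgl (c n)) (A n ω) (B n ω) ≠ 0}) atTop (𝓝 0) := by
  have hbound : Tendsto
      (fun n : ℕ => (m₂ n : ℝ) / n ^ 2 / (4 * ((m₁ n + m₂ n / 2 : ℝ) / n - 1) ^ 2))
      atTop (𝓝 0) := by
    have hne : 4 * (α - 1) ^ 2 ≠ 0 := by
      have := sub_pos.2 hα
      positivity
    simpa only [zero_div] using!
      (tendsto_div_sq_zero hm).div (((hm.sub_const 1).pow 2).const_mul 4) hne
  refine squeeze_zero' (Eventually.of_forall fun _ => measureReal_nonneg) ?_ hbound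
  filter_upwards [hm.eventually_const_lt hα, eventually_gt_atTop 0] with n hlt hn
  have hn' : (0 : ℝ) < n := by exact_mod_cast hn
  have hproj := measureReal_coneProj_ne_zero_le (κ := Fin (m₁ n)) (ι := Fin (m₂ n)) (-c n)
    (by simpa [one_lt_div hn'] using hlt)
  simp only [Fintype.card_fin, finrank_euclideanSpace] at hproj
  refine ((hAB n).measureReal_xiH_mem (c n) (measurableSet_singleton 0).compl).trans_le ?_
  simp only [Set.mem_compl_singleton_iff, ne_eq, neg_eq_zero, norm_eq_zero]
  refine hproj.trans_eq ?_
  rw [div_sub_one hn'.ne', div_div, div_pow]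
  field_simp

theorem tendsto_measure_xiH_between [∀ n, IsProbabilityMeasure (P n)]
    (hm : Tendsto (fun n : ℕ => (m₁ n + m₂ n / 2 : ℝ) / n) atTop (𝓝 α))
    (hAB : ∀ n, IsStdGaussianPair (P n) (A n) (B n)) (c : ∀ n, EuclideanSpace ℝ (Fin n))
    {γl γu : ℝ} (hl : γl < α) (hu : α < γu) :
    Tendsto (fun n => P n {ω | -√(1 - γl) * ‖c n‖ ≤ xiH (fgl (c n)) (A n ω) (B n ω) ∧
      xiH (fgl (c n)) (A n ω) (B n ω) ≤ -√(1 - γu) * ‖c n‖}) atTop (𝓝 1) := by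
  rcases le_or_gt α 1 with hα | hα
  · have ht : 0 < min (α - γl) (γu - α) := lt_min (sub_pos.2 hl) (sub_pos.2 hu)
    refine tendsto_measure_one_of_tendsto_measureReal_zero
      (tendsto_measureReal_lt_abs_xiH_sq_sub hm hAB c ht) (Eventually.of_forall fun n ω hω => ?_)
    have hclose := not_lt.1 (Set.mem_ofPred_eq ▸ hω)
    rw [max_eq_right (sub_nonneg.2 hα)] at hclose
    refine ⟨neg_sqrt_mul_le_of_abs_sq_sub_le (norm_nonneg _) hclose ?_,
      le_neg_sqrt_mul_of_abs_sq_sub_le (norm_nonneg _) ?_ hclose ?_⟩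
    · linarith [min_le_left (α - γl) (γu - α)]
    · simp [xiH_fgl_eq_neg_norm_coneProj]
    · linarith [min_le_right (α - γl) (γu - α)]
  · refine tendsto_measure_one_of_tendsto_measureReal_zero
      (tendsto_measureReal_xiH_ne_zero hm hAB c hα) (Eventually.of_forall fun n ω hω => ?_)
    have hzero : xiH (fgl (c n)) (A n ω) (B n ω) = 0 := not_not.1 hω
    have hsqrt : √(1 - γu) = 0 := Real.sqrt_eq_zero_of_nonpos (by linarith)
    simp only [Set.mem_ofPred_eq, hzero, hsqrt, neg_zero, zero_mul, le_refl, and_true]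
    exact mul_nonpos_of_nonpos_of_nonneg (neg_nonpos.2 (Real.sqrt_nonneg _)) (norm_nonneg _)

theorem tendsto_measure_xiH_strictly_between [∀ n, IsProbabilityMeasure (P n)]
    (hm : Tendsto (fun n : ℕ => (m₁ n + m₂ n / 2 : ℝ) / n) atTop (𝓝 α))
    (hAB : ∀ n, IsStdGaussianPair (P n) (A n) (B n)) {c : ∀ n, EuclideanSpace ℝ (Fin n)}
    (hc : ∀ᶠ n in atTop, c n ≠ 0) (hα : α < 1) {γl γu : ℝ} (hl : γl < α) (hu : α < γu) :
    Tendsto (fun n => P n {ω | -√(1 - γl) * ‖c n‖ < xiH (fgl (c n)) (A n ω) (B n ω) ∧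
      xiH (fgl (c n)) (A n ω) (B n ω) < -√(1 - γu) * ‖c n‖}) atTop (𝓝 1) := by
  obtain ⟨γl', hll', hl'⟩ := exists_between hl
  obtain ⟨γu', hu', huu'⟩ := exists_between (lt_min hα hu)
  have hsqrtl : √(1 - γl') < √(1 - γl) :=
    (Real.sqrt_lt_sqrt_iff_of_pos (by linarith)).2 (by linarith)
  have hsqrtu : √(1 - γu) < √(1 - γu') :=
    (Real.sqrt_lt_sqrt_iff_of_pos (sub_pos.2 (lt_min_iff.1 huu').1)).2
      (by linarith [(lt_min_iff.1 huu').2])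
  refine tendsto_of_tendsto_of_tendsto_of_le_of_le'
    (tendsto_measure_xiH_between hm hAB c hl' hu') tendsto_const_nhds ?_
    (Eventually.of_forall fun n => prob_le_one)
  filter_upwards [hc] with n hcn
  have hnorm := norm_pos_iff.2 hcn
  refine measure_mono fun ω hω => ⟨lt_of_lt_of_le ?_ hω.1, lt_of_le_of_lt hω.2 ?_⟩
  · exact mul_lt_mul_of_pos_right (neg_lt_neg hsqrtl) hnorm
  · exact mul_lt_mul_of_pos_right (neg_lt_neg hsqrtu) hnorm

end Limits

section Thresholds

variable {α₁ α₂ ε₁ ε₅ : ℝ} {n : ℕ}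

theorem Cgl_mul_sqrt (c : EuclideanSpace ℝ (Fin n)) : Cgl c * √n = ‖c‖ := by
  rcases n.eq_zero_or_pos with rfl | hn
  · simp [Subsingleton.elim c 0]
  · exact div_mul_cancel₀ _ (Real.sqrt_pos.2 (Nat.cast_pos.2 hn)).ne'

-- The square root of a negative number is `0`, so one formula covers both branches of `xiDl`.
theorem Cgl_mul_xiDl (c : EuclideanSpace ℝ (Fin n)) :
    Cgl c * xiDl α₁ α₂ ε₁ ε₅ n = -√(1 - sqrtDl α₁ α₂ ε₁ ε₅ ^ 2) * ‖c‖ := by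
  rw [xiDl, ← Cgl_mul_sqrt c]
  split_ifs with h
  · ring
  · rw [Real.sqrt_eq_zero_of_nonpos (sub_nonpos.2 (not_le.1 h).le), neg_zero, zero_mul, mul_zero]

theorem Cgl_mul_xiDu (c : EuclideanSpace ℝ (Fin n)) :
    Cgl c * xiDu α₁ α₂ ε₁ ε₅ n = -√(1 - sqrtDu α₁ α₂ ε₁ ε₅ ^ 2) * ‖c‖ := by
  rw [xiDu, ← Cgl_mul_sqrt c]
  split_ifs with h
  · ring
  · rw [Real.sqrt_eq_zero_of_nonpos (sub_nonpos.2 (not_le.1 h).le), neg_zero, zero_mul, mul_zero]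

theorem sqrtDl_sq_lt (hε₁ : 0 < ε₁) (hε₅ : 0 < ε₅) (h : 0 ≤ sqrtDl α₁ α₂ ε₁ ε₅) :
    sqrtDl α₁ α₂ ε₁ ε₅ ^ 2 < α₁ + α₂ / 2 := by
  refine (Real.lt_sqrt h).1 ?_
  rw [sqrtDl, sub_mul, one_mul]
  linarith [mul_nonneg hε₁.le (Real.sqrt_nonneg (α₁ + α₂ / 2))]

theorem lt_sqrtDu_sq (hε₁ : 0 < ε₁) (hε₅ : 0 < ε₅) :
    α₁ + α₂ / 2 < sqrtDu α₁ α₂ ε₁ ε₅ ^ 2 := by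
  refine Real.lt_sq_of_sqrt_lt ?_
  rw [sqrtDu, add_mul, one_mul]
  linarith [mul_nonneg hε₁.le (Real.sqrt_nonneg (α₁ + α₂ / 2))]

end Thresholds

end RandomProgram

open RandomProgram in
theorem mainTheorem4_general {m₁ m₂ : ℕ → ℕ} {α γl γu : ℝ}
    (hm : Tendsto (fun n : ℕ => (m₁ n + m₂ n / 2 : ℝ) / n) atTop (𝓝 α))
    (hl : γl < α) (hu : α < γu) (c : ∀ n : ℕ, EuclideanSpace ℝ (Fin n))
    {Ω : ℕ → Type*} [∀ n, MeasurableSpace (Ω n)]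
    {P : ∀ n, Measure (Ω n)} [∀ n, IsProbabilityMeasure (P n)]
    {A : ∀ n, Ω n → Matrix (Fin (m₁ n)) (Fin n) ℝ} {B : ∀ n, Ω n → Matrix (Fin (m₂ n)) (Fin n) ℝ}
    (hAB : ∀ n, IsStdGaussianPair (P n) (A n) (B n)) :
    (α < 1 → (∀ᶠ n in atTop, c n ≠ 0) →
      Tendsto (fun n => P n {ω | -√(1 - γl) * ‖c n‖ < xiH (fgl (c n)) (A n ω) (B n ω) ∧
        xiH (fgl (c n)) (A n ω) (B n ω) < -√(1 - γu) * ‖c n‖}) atTop (𝓝 1)) ∧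
    Tendsto (fun n => P n {ω | -√(1 - γl) * ‖c n‖ ≤ xiH (fgl (c n)) (A n ω) (B n ω) ∧
      xiH (fgl (c n)) (A n ω) (B n ω) ≤ -√(1 - γu) * ‖c n‖}) atTop (𝓝 1) :=
  ⟨fun hα hc => tendsto_measure_xiH_strictly_between hm hAB hc hα hl hu,
    tendsto_measure_xiH_between hm hAB c hl hu⟩

theorem mainTheorem4
    (α₁ α₂ ε₁ ε₅ : ℝ) (hε₁ : 0 < ε₁) (hε₅ : 0 < ε₅)
    -- the constants `ε₁`, `ε₅` are small: `√D⁽ˡ⁾` is a genuine (non-negative) square root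
    (hsmall : 0 ≤ RandomProgram.sqrtDl α₁ α₂ ε₁ ε₅)
    -- linear regime
    (m₁ m₂ : ℕ → ℕ)
    (hm₁ : Tendsto (fun n : ℕ => (m₁ n : ℝ) / n) atTop (𝓝 α₁))
    (hm₂ : Tendsto (fun n : ℕ => (m₂ n : ℝ) / n) atTop (𝓝 α₂))
    -- deterministic cost vectors with bounded `C_gl`
    (c : ∀ n : ℕ, EuclideanSpace ℝ (Fin n))
    (hc : ∃ K : ℝ, ∀ n, RandomProgram.Cgl (c n) ≤ K)
    -- Gaussian matrices
    {Ω : ℕ → Type*} [∀ n, MeasurableSpace (Ω n)]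
    (P : ∀ n, Measure (Ω n)) [∀ n, IsProbabilityMeasure (P n)]
    (A : ∀ n, Ω n → Matrix (Fin (m₁ n)) (Fin n) ℝ)
    (B : ∀ n, Ω n → Matrix (Fin (m₂ n)) (Fin n) ℝ)
    (hAB : ∀ n, RandomProgram.IsStdGaussianPair (P n) (A n) (B n)) :
    (α₁ + α₂ / 2 < 1 → (∀ᶠ n in atTop, c n ≠ 0) →
      Tendsto (fun n : ℕ => P n {ω |
          RandomProgram.Cgl (c n) * RandomProgram.xiDl α₁ α₂ ε₁ ε₅ n <
            RandomProgram.xiH (RandomProgram.fgl (c n)) (A n ω) (B n ω) ∧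
          RandomProgram.xiH (RandomProgram.fgl (c n)) (A n ω) (B n ω) <
            RandomProgram.Cgl (c n) * RandomProgram.xiDu α₁ α₂ ε₁ ε₅ n})
        atTop (𝓝 1)) ∧
    Tendsto (fun n : ℕ => P n {ω |
        RandomProgram.Cgl (c n) * RandomProgram.xiDl α₁ α₂ ε₁ ε₅ n ≤
          RandomProgram.xiH (RandomProgram.fgl (c n)) (A n ω) (B n ω) ∧
        RandomProgram.xiH (RandomProgram.fgl (c n)) (A n ω) (B n ω) ≤
          RandomProgram.Cgl (c n) * RandomProgram.xiDu α₁ α₂ ε₁ ε₅ n})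
      atTop (𝓝 1) := by
  simpa only [RandomProgram.Cgl_mul_xiDl, RandomProgram.Cgl_mul_xiDu] using
    mainTheorem4_general (by simpa only [add_div, div_right_comm] using hm₁.add (hm₂.div_const 2))
      (RandomProgram.sqrtDl_sq_lt hε₁ hε₅ hsmall) (RandomProgram.lt_sqrtDu_sq hε₁ hε₅) c hAB
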